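/- **Setting.** Let $n\ge 2$, $\frac{(n-2)_+}{n+2}<m<1$ and $0<\nu\le L<\infty$. Let $E\subset\mathbb R^n$ be open and bounded, $T>0$, $E_T=E\times(0,T)$, and $f\in L^\infty_{\rm loc}(E_T)$. Let $A:E_T\times\mathbb R\times\mathbb R^n\to\mathbb R^n$ be measurable with $$A(x,t,s,\xi)\cdot\xi\ge\nu|\xi|^2,\qquad |A(x,t,s,\xi)|\le L|\xi|$$ for a.e. $(x,t)\in E_T$ and all $(s,\xi)\in\mathbb R\times\mathbb R^n$. A local weak solution $u\ge0$ of $u_t-\operatorname{div}A(x,t,u,Du^m)=f$ in $E_T$ is a nonnegative function $u\in C^0_{\rm loc}(0,T;L^{m+1}_{\rm loc}(E))$ with $u^m\in L^2_{\rm loc}(0,T;W^{1,2}_{\rm loc}(E))$ such that $$\iint_{E_T}\big(-u\,\phi_t+A(x,t,u,Du^m)\cdot D\phi\big)\,dx\,dt=\iint_{E_T}f\phi\,dx\,dt\qquad\text{for all }\phi\in C_0^\infty(E_T),$$ where $D$ is the (weak) gradient in $x$. For $\tau,\rho>0$ and $z_o=(x_o,t_o)$ let $B_\rho(x_o)=\{x\in\mathbb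 R^n:|x-x_o|<\rho\}$, $\Lambda_\tau(t_o)=(t_o-\tau,t_o+\tau)$ and let $Q_{\tau,\rho}(z_o)$ be the cylinder of points $(x,t)$ with $x\in B_\rho(x_o)$, $t\in\Lambda_\tau(t_o)$. **Lemma 4.1.** There is a constant $\gamma>1$, depending only on $n,m,\nu,L$, such that for all $E,T,A,f$ as above, every local weak solution $u\ge0$ in $E_T$, every $z_o=(x_o,t_o)\in E_T$ and $\theta,\rho>0$ with $Q_{\theta(2\rho)^2,2\rho}(z_o)\subset E_T$, and every $c\ge0$, $$\begin{aligned} &\operatorname*{ess\,sup}_{t\in\Lambda_{\theta\rho^2}(t_o)}\int_{B_\rho(x_o)}|u^m-c^m|^{\frac{m+1}m}\,dx+\operatorname*{ess\,sup}_{t\in\Lambda_{\theta\rho^2}(t_o)}\int_{B_\rho(x_o)}|u^m-c^m||u-c|\,dx+\iint_{Q_{\theta\rho^2,\rho}(z_o)}|Du^m|^2\,dx\,dt\\ &\quad\le\frac{\gamma}{\theta\rho^2}\iint_{Q_{\theta(2\rho)^2,2\rho}(z_o)}|u^m-c^m||u-c|\,dx\,dt+\frac{\gamma}{\rho^2}\iint_{Q_{\theta(2\rho)^2,2\rho}(z_o)}|u^m-c^m|^2\,dx\,dt+\gamma\iint_{Q_{\theta(2\rho)^2,2\rho}(z_o)}\rho^2|f|^2\,dx\,dt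 \end{aligned}$$ and $$\begin{aligned} &\operatorname*{ess\,sup}_{t\in\Lambda_{\theta\rho^2}(t_o)}\int_{B_\rho(x_o)}|u^m-c^m|^{\frac{m+1}m}\,dx+\iint_{Q_{\theta\rho^2,\rho}(z_o)}|Du^m|^2\,dx\,dt\\ &\quad\le\frac{\gamma}{\theta\rho^2}\iint_{Q_{\theta(2\rho)^2,2\rho}(z_o)}|u-c|^{m+1}\,dx\,dt+\frac{\gamma}{\rho^2}\iint_{Q_{\theta(2\rho)^2,2\rho}(z_o)}|u-c|^{2m}\,dx\,dt+\gamma\iint_{Q_{\theta(2\rho)^2,2\rho}(z_o)}\rho^2|f|^2\,dx\,dt. \end{aligned}$$ All integrals are of nonnegative functions, with values in $[0,\infty]$. -/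

import Mathlib

open MeasureTheory Set Filter Topology
open scoped ENNReal ContDiff

namespace PME

/-- Euclidean space `ℝⁿ` with the Euclidean norm and Lebesgue measure. -/
abbrev Rn (n : ℕ) : Type := EuclideanSpace ℝ (Fin n)

/-- The space-time domain `E_T = E × (0, T)`; its points are written `(x, t)`. -/
def spaceTime {n : ℕ} (E : Set (Rn n)) (T : ℝ) : Set (Rn n × ℝ) :=
  E ×ˢ Ioo 0 T

/-- The time interval of half-width `τ` centred at `t₀`. -/
def timeInterval (t₀ τ : ℝ) : Set ℝ := Ioo (t₀ - τ) (t₀ + τ)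

/-- The cylinder `Q_{τ,ρ}(x₀, t₀)`: the (full) open ball of radius `ρ` about `x₀` times the
time interval `(t₀ - τ, t₀ + τ)`. -/
def parabolicCylinder {n : ℕ} (z₀ : Rn n × ℝ) (τ ρ : ℝ) : Set (Rn n × ℝ) :=
  Metric.ball z₀.1 ρ ×ˢ timeInterval z₀.2 τ

/-- `g ∈ L^p_loc(U)`: `g ∈ L^p(K)` for every compact `K ⊆ U`. -/
def MemLpLoc {X F : Type*} [TopologicalSpace X] [MeasureSpace X] [NormedAddCommGroup F]
    (g : X → F) (p : ℝ≥0∞) (U : Set X) : Prop :=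
  ∀ K : Set X, IsCompact K → K ⊆ U → MemLp g p (volume.restrict K)

/-- `φ ∈ C_0^∞(U)`, real valued. -/
structure IsTestFunction {V : Type*} [NormedAddCommGroup V] [NormedSpace ℝ V]
    (U : Set V) (φ : V → ℝ) : Prop where
  contDiff : ContDiff ℝ ∞ φ
  hasCompactSupport : HasCompactSupport φ
  tsupport_subset : tsupport φ ⊆ U

/-- `g` is the weak (distributional) gradient of `w` on the open set `U ⊆ ℝⁿ`. -/
structure HasWeakGradientOn {n : ℕ} (U : Set (Rn n)) (w : Rn n → ℝ) (g : Rn n → Rn n) : Prop where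
  memLpLoc : MemLpLoc w 1 U
  memLpLoc_grad : MemLpLoc g 1 U
  integral_eq : ∀ φ : Rn n → ℝ, IsTestFunction U φ →
    ∫ x in U, w x • gradient φ x = - ∫ x in U, φ x • g x

/-- `w ∈ L²_loc(0, T; W^{1,2}_loc(E))`, with `G` its weak gradient `Dw` in the space variables. -/
structure MemL2W12LocWithGradient {n : ℕ} (E : Set (Rn n)) (T : ℝ)
    (w : Rn n × ℝ → ℝ) (G : Rn n × ℝ → Rn n) : Prop where
  memLpLoc : MemLpLoc w 2 (spaceTime E T)
  memLpLoc_grad : MemLpLoc G 2 (spaceTime E T)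
  weakGradient : ∀ᵐ t ∂(volume.restrict (Ioo 0 T)),
    HasWeakGradientOn E (fun x => w (x, t)) (fun x => G (x, t))

/-- `u ∈ C⁰_loc(0, T; L^p_loc(E))`, for a (jointly measurable) function `u` of `(x, t)`. -/
structure MemContTimeLpLoc {n : ℕ} (E : Set (Rn n)) (T : ℝ) (p : ℝ≥0∞)
    (u : Rn n × ℝ → ℝ) : Prop where
  aestronglyMeasurable : AEStronglyMeasurable u (volume.restrict (spaceTime E T))
  memLpLoc : ∀ t ∈ Ioo 0 T, MemLpLoc (fun x => u (x, t)) p E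
  continuous : ∀ K : Set (Rn n), IsCompact K → K ⊆ E → ∀ t₀ ∈ Ioo 0 T,
    Tendsto (fun t => eLpNorm (fun x => u (x, t) - u (x, t₀)) p (volume.restrict K))
      (𝓝 t₀) (𝓝 0)

/-- The vector field `A(x, t, s, ξ)` on `E_T × ℝ × ℝⁿ` is measurable and satisfies, for a.e.
`(x, t) ∈ E_T` and all `(s, ξ)`, the ellipticity and growth conditions with constants `ν`, `L`.
Measurability refers to the product of the Lebesgue σ-algebra of `E_T`
and the Borel σ-algebra of `ℝ × ℝⁿ`. -/
structure StructureConditions {n : ℕ} (E : Set (Rn n)) (T ν L : ℝ)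
    (A : Rn n × ℝ → ℝ → Rn n → Rn n) : Prop where
  measurable : Measurable
    (fun p : NullMeasurableSpace (Rn n × ℝ) (volume.restrict (spaceTime E T)) × (ℝ × Rn n) =>
      A p.1 p.2.1 p.2.2)
  coercive : ∀ᵐ z ∂(volume.restrict (spaceTime E T)), ∀ (s : ℝ) (ξ : Rn n),
    ν * ‖ξ‖ ^ 2 ≤ inner ℝ (A z s ξ) ξ
  growth : ∀ᵐ z ∂(volume.restrict (spaceTime E T)), ∀ (s : ℝ) (ξ : Rn n),
    ‖A z s ξ‖ ≤ L * ‖ξ‖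

/-- `u ≥ 0` is a local weak solution of `u_t - div A(x, t, u, Du^m) = f` in `E_T`, where
`G = D(u^m)` is the weak spatial gradient of `u^m`. -/
structure IsNonnegLocalWeakSolution {n : ℕ} (E : Set (Rn n)) (T m : ℝ)
    (A : Rn n × ℝ → ℝ → Rn n → Rn n) (f : Rn n × ℝ → ℝ)
    (u : Rn n × ℝ → ℝ) (G : Rn n × ℝ → Rn n) : Prop where
  nonneg : ∀ᵐ z ∂(volume.restrict (spaceTime E T)), 0 ≤ u z
  continuous : MemContTimeLpLoc E T (ENNReal.ofReal (m + 1)) u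
  sobolev : MemL2W12LocWithGradient E T (fun z => u z ^ m) G
  integral_eq : ∀ φ : Rn n × ℝ → ℝ, IsTestFunction (spaceTime E T) φ →
    ∫ z in spaceTime E T,
        (- u z * deriv (fun t => φ (z.1, t)) z.2
          + inner ℝ (A z (u z) (G z)) (gradient (fun x => φ (x, z.2)) z.1))
      = ∫ z in spaceTime E T, f z * φ z

end PME

open PME

/-! The estimate comes from testing the equation with `W = χ(t) ζ(x)² (u^m - c^m)`. This is not an
admissible test function: it is not smooth, and `u` has no time derivative. The proof avoids time
averages of the equation. For every smooth `η` supported near the origin, the space-time convolution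
`η * W` is admissible, and Fubini turns the weak formulation into `∫ J ∂ₜη = ∫ b η`. Here `J(y) = ∫
u(z) W(z - y) dz`, and `b` is the corresponding correlation of the flux with `DW` minus that of `f`
with `W`. So `∂ₜJ = -b` in the sense of distributions near `0`. Both functions are continuous,
because translations are continuous in `L^q` for `q < ∞`; for `J` the exponents are `m + 1` and `(m
+ 1)/m`. Hence `J` is classically differentiable in time at `0`, with derivative `-b(0)`
(`hasDerivAt_correlation`).

The backward difference quotient of `J` is `h⁻¹ ∫ (u(z) - u(z - h e)) W(z) dz`. Let `F` be the
Bregman divergence of `s^(m+1)/(m+1)` between `u` and `c`. Convexity bounds this quotient from below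
by the same expression with `F` in place of `u` and `χ ζ²` in place of `W`. Moving the shift onto
`χ` and letting `h → 0` gives `b(0) ≤ ∫ F ζ² χ'` (`integral_cutoff_le`). Ellipticity, growth and
Young's inequality then give the energy inequality (`energy_le`).

A trapezoidal `χ` yields both bounds (`cylinder_bounds`). Its rising ramp produces the term with
`1/(θρ²)`. Its falling ramp bounds averages of `∫ F ζ² dx` over arbitrary short time intervals,
hence almost every time slice by Lebesgue differentiation. The gradient bound comes from a plateau
over the inner time interval. Finally `F` is comparable to `(u^m - c^m)(u - c)`, and the `m`-Hölder
continuity of `s ↦ s^m` gives the remaining power comparisons. -/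

/-! ### Convolution, and classical from distributional directional derivatives -/

open scoped Convolution in
/-- The derivative of a convolution with a smooth compactly supported function falls on that
function. -/
theorem hasFDerivAt_smul_convolution {X F : Type*} [NormedAddCommGroup X] [NormedSpace ℝ X]
    [FiniteDimensional ℝ X] [MeasurableSpace X] [BorelSpace X]
    [NormedAddCommGroup F] [NormedSpace ℝ F] [CompleteSpace F]
    {μ : Measure X} [μ.IsAddHaarMeasure] {η : X → ℝ} {g : X → F} (hη : ContDiff ℝ 1 η)
    (hηc : HasCompactSupport η) (hg : LocallyIntegrable g μ) (x : X) :
    ∃ D : X →L[ℝ] F, HasFDerivAt (fun z => ∫ y, η y • g (z - y) ∂μ) D x ∧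
      ∀ e, D e = ∫ y, fderiv ℝ η y e • g (x - y) ∂μ := by
  refine ⟨_, hηc.hasFDerivAt_convolution_left (ContinuousLinearMap.lsmul ℝ ℝ) hη hg x, ?_⟩
  intro e
  have hex := (hηc.fderiv ℝ).convolutionExists_left
    ((ContinuousLinearMap.lsmul ℝ ℝ : ℝ →L[ℝ] F →L[ℝ] F).precompL X)
    (hη.continuous_fderiv one_ne_zero) hg x
  rw [convolution_def, ContinuousLinearMap.integral_apply hex]
  rfl

/-- A continuous distributional derivative of a continuous function is a classical one, even if it
is known only in one direction and only near the origin. Mollifications of `J` have derivative minus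
the mollification of `b`; the mean value inequality is uniform in the mollifier, so it passes to the
limit. -/
theorem hasDerivAt_of_integral_fderiv_eq {X : Type*} [NormedAddCommGroup X] [NormedSpace ℝ X]
    [FiniteDimensional ℝ X] [MeasurableSpace X] [BorelSpace X]
    {μ : Measure X} [μ.IsAddHaarMeasure] {J b : X → ℝ} (hJ : Continuous J) (hb : Continuous b)
    (e : X) {r : ℝ} (hr : 0 < r)
    (h : ∀ η : X → ℝ, ContDiff ℝ ∞ η → HasCompactSupport η → tsupport η ⊆ Metric.ball 0 r →
      ∫ y, J y * fderiv ℝ η y e ∂μ = ∫ y, b y * η y ∂μ) :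
    HasDerivAt (fun τ : ℝ => J (τ • e)) (-b 0) 0 := by
  rw [hasDerivAt_iff_isLittleO, Asymptotics.isLittleO_iff]
  intro δ hδ
  obtain ⟨r₁, hr₁, hr₁b⟩ := Metric.continuousAt_iff.1 hb.continuousAt (δ / 4) (by positivity)
  -- Half for the segment `σ • e`, half for the radius of the mollifier: their sum stays inside both
  -- the ball where the identity is known and the ball where `b` is nearly constant.
  set s := min r r₁ / 2 with hs
  have hs0 : 0 < s := by positivity
  have hsr : s + s ≤ r := by rw [hs]; linarith [min_le_left r r₁]
  have hsr₁ : s + s ≤ r₁ := by rw [hs]; linarith [min_le_right r r₁]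
  have hsmall : ∀ᶠ τ : ℝ in 𝓝 0, ‖τ • e‖ < s := by
    have : Tendsto (fun τ : ℝ => ‖τ • e‖) (𝓝 0) (𝓝 ‖(0 : ℝ) • e‖) :=
      (Continuous.tendsto (by fun_prop) 0)
    rw [zero_smul, norm_zero] at this
    exact this.eventually (gt_mem_nhds hs0)
  filter_upwards [hsmall] with τ hτ
  set φ : ℕ → ContDiffBump (0 : X) := fun k =>
    ⟨s / (2 * (k + 2)), s / (k + 2), by positivity, by
      have : (0:ℝ) < k + 2 := by positivity
      gcongr; linarith⟩ with hφ
  have hφs : ∀ k, (φ k).rOut < s := fun k => by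
    change s / (k + 2) < s
    rw [div_lt_iff₀ (by positivity)]; nlinarith [hs0, (Nat.cast_nonneg k : (0:ℝ) ≤ k)]
  have hφ0 : Tendsto (fun k => (φ k).rOut) atTop (𝓝 0) := by
    have := (tendsto_const_nhds (x := s)).div_atTop
      (tendsto_atTop_add_const_right atTop (2:ℝ) tendsto_natCast_atTop_atTop)
    simpa [hφ] using this
  have hlim := fun x => ContDiffBump.convolution_tendsto_right_of_continuous (μ := μ) hφ0 hJ x
  have hmain : ∀ k, ‖(∫ y, (φ k).normed μ y • J (τ • e - y) ∂μ)
      - (∫ y, (φ k).normed μ y • J (0 - y) ∂μ) + τ * b 0‖ ≤ δ * ‖τ‖ := by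
    intro k
    set ψ := (φ k).normed μ with hψ
    have hψs : ContDiff ℝ ∞ ψ := (φ k).contDiff_normed
    have hψc : HasCompactSupport ψ := (φ k).hasCompactSupport_normed
    set g : ℝ → ℝ := fun σ => (∫ y, ψ y • J (σ • e - y) ∂μ) + σ * b 0 with hgdef
    have hder : ∀ σ ∈ Icc (-|τ|) |τ|, HasDerivWithinAt g
        (-(∫ y, ψ y • b (σ • e - y) ∂μ) + b 0) (Icc (-|τ|) |τ|) σ := by
      intro σ hσ
      have hσ' : ‖σ • e‖ < s := by
        rw [norm_smul] at hτ ⊢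
        refine lt_of_le_of_lt ?_ hτ
        gcongr
        exact abs_le.2 hσ
      obtain ⟨D, hD, hDe⟩ := hasFDerivAt_smul_convolution (μ := μ) (g := J)
        (hψs.of_le (by simp)) hψc hJ.locallyIntegrable (σ • e)
      have h1 : HasDerivAt (fun σ : ℝ => ∫ y, ψ y • J (σ • e - y) ∂μ) (D e) σ := by
        have := HasFDerivAt.comp_hasDerivAt σ hD ((hasDerivAt_id σ).smul_const e)
        simpa [Function.comp_def] using this
      have h2 : D e = -(∫ y, ψ y • b (σ • e - y) ∂μ) := by
        -- The reflected and translated bump converts the distributional identity into the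
        -- derivative of the mollified `J` at `σ • e`.
        have hη := h (fun y => ψ (σ • e - y)) (by fun_prop)
          (hψc.comp_homeomorph (Homeomorph.subLeft (σ • e))) (by
            have : tsupport (fun y => ψ (σ • e - y)) ⊆ Metric.closedBall (σ • e) (φ k).rOut := by
              refine closure_minimal ?_ Metric.isClosed_closedBall
              intro y hy
              have hy' : σ • e - y ∈ Function.support ψ := hy
              rw [hψ, ContDiffBump.support_normed_eq] at hy'
              rw [mem_closedBall_iff_norm']
              exact (mem_ball_zero_iff.1 hy').le
            refine this.trans fun y hy => ?_
            rw [mem_closedBall_iff_norm] at hy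
            rw [mem_ball_zero_iff]
            calc ‖y‖ = ‖(y - σ • e) + σ • e‖ := by simp
              _ ≤ ‖y - σ • e‖ + ‖σ • e‖ := norm_add_le _ _
              _ < r := by linarith [hφs k])
        rw [hDe, ← integral_sub_left_eq_self _ μ (σ • e),
          ← integral_sub_left_eq_self (fun y => ψ y • b (σ • e - y)) μ (σ • e)]
        have hfd : ∀ y, fderiv ℝ (fun y => ψ (σ • e - y)) y e = - fderiv ℝ ψ (σ • e - y) e := by
          intro y
          have hd : HasFDerivAt ψ (fderiv ℝ ψ (σ • e - y)) (σ • e - y) :=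
            (hψs.differentiable (by simp)).differentiableAt.hasFDerivAt
          have := HasFDerivAt.comp y hd ((hasFDerivAt_id y).const_sub (σ • e))
          have h3 := this.fderiv
          simp only [Function.comp_def] at h3
          rw [h3]; simp
        simp only [hfd, sub_sub_cancel, smul_eq_mul, mul_neg, integral_neg] at hη ⊢
        simp only [mul_comm (ψ _), ← hη, neg_neg, mul_comm (J _)]
      rw [← h2]
      exact (h1.add (by simpa using (hasDerivAt_id σ).mul_const (b 0))).hasDerivWithinAt
    have hbd : ∀ σ ∈ Icc (-|τ|) |τ|, ‖-(∫ y, ψ y • b (σ • e - y) ∂μ) + b 0‖ ≤ δ := by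
      intro σ hσ
      have hσ' : ‖σ • e‖ < s := by
        rw [norm_smul] at hτ ⊢
        refine lt_of_le_of_lt ?_ hτ
        gcongr
        exact abs_le.2 hσ
      have h1 : dist (b (σ • e)) (b 0) < δ / 4 := hr₁b (by
        rw [dist_zero_right]; linarith)
      have h2 : dist (∫ y, ψ y • b (σ • e - y) ∂μ) (b (σ • e)) ≤ δ / 2 := by
        refine (φ k).dist_normed_convolution_le (μ := μ) (g := b) hb.aestronglyMeasurable ?_
        intro x hx
        have h3 : dist (b x) (b 0) < δ / 4 := hr₁b (by
          rw [dist_zero_right]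
          rw [mem_ball_iff_norm] at hx
          calc ‖x‖ = ‖(x - σ • e) + σ • e‖ := by simp
              _ ≤ ‖x - σ • e‖ + ‖σ • e‖ := norm_add_le _ _
              _ < r₁ := by linarith [hφs k])
        linarith [dist_triangle_right (b x) (b (σ • e)) (b 0)]
      rw [Real.dist_eq] at h1 h2
      simp only [smul_eq_mul, Real.norm_eq_abs] at h2 ⊢
      rw [abs_le]
      constructor <;> linarith [abs_le.1 h1.le, abs_le.1 h2]
    have := (convex_Icc (-|τ|) |τ|).norm_image_sub_le_of_norm_hasDerivWithin_le hder hbd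
      (x := 0) (y := τ) (by simp) ⟨neg_abs_le τ, le_abs_self τ⟩
    simpa [hgdef, add_sub_right_comm] using this
  have hL := (((hlim (τ • e)).sub (hlim 0)).add_const (τ * b 0)).norm
  have := le_of_tendsto' hL hmain
  simpa [sub_eq_add_neg] using this

/-! ### Correlations of functions in conjugate Lebesgue spaces -/

/-- The correlation of `u ∈ L^p` and `W ∈ L^q`, `1/p + 1/q = 1`, is continuous. -/
theorem continuous_integral_correlation {X E F : Type*} [NormedAddCommGroup X] [NormedSpace ℝ X]
    [FiniteDimensional ℝ X] [MeasurableSpace X] [BorelSpace X]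
    [NormedAddCommGroup E] [NormedSpace ℝ E] [NormedAddCommGroup F] [NormedSpace ℝ F]
    {μ : Measure X} [μ.IsAddHaarMeasure] (B : E →L[ℝ] F →L[ℝ] ℝ) (p q : ℝ≥0∞)
    [p.HolderConjugate q] (hq : q ≠ ⊤) {u : X → E} {W : X → F}
    (hu : MemLp u p μ) (hW : MemLp W q μ) :
    Continuous fun y => ∫ z, B (u z) (W (z - y)) ∂μ := by
  have : Fact (1 ≤ p) := ⟨ENNReal.HolderConjugate.one_le p q⟩
  have : Fact (1 ≤ q) := ⟨ENNReal.HolderConjugate.one_le q p⟩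
  have : Fact (q ≠ ⊤) := ⟨hq⟩
  -- Written as the duality pairing with a translate of `W`, the correlation inherits continuity
  -- from the translation action on `L^q`, which is continuous for `q < ∞`.
  have key : ∀ y, ∫ z, B (u z) (W (z - y)) ∂μ
      = B.lpPairing μ p q (hu.toLp u) (DomAddAct.mk (-y) +ᵥ hW.toLp W) := by
    intro y
    rw [ContinuousLinearMap.lpPairing_eq_integral]
    refine integral_congr_ae ?_
    have h2 : (DomAddAct.mk (-y) +ᵥ hW.toLp W : Lp F q μ) =ᵐ[μ] fun z => W (-y + z) := by
      rw [DomAddAct.mk_vadd_toLp]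
      exact MemLp.coeFn_toLp _
    filter_upwards [hu.coeFn_toLp, h2] with z h1 h2
    rw [h1, h2, neg_add_eq_sub]
  simp_rw [key]
  have hc : Continuous fun y : X => (DomAddAct.mk (-y) +ᵥ hW.toLp W : Lp F q μ) :=
    Continuous.vadd (DomAddAct.continuous_mk.comp continuous_neg) continuous_const
  exact (B.lpPairing μ p q (hu.toLp u)).continuous.comp hc

/-- Fubini. It takes the mollifier off the test function and makes it a weight on the correlation,
which is how the weak formulation becomes a distributional identity in the shift `y`. -/
theorem integral_bilin_convolution_eq {X E F : Type*} [NormedAddCommGroup X] [NormedSpace ℝ X]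
    [FiniteDimensional ℝ X] [MeasurableSpace X] [BorelSpace X]
    [NormedAddCommGroup E] [NormedSpace ℝ E] [NormedAddCommGroup F] [NormedSpace ℝ F]
    [CompleteSpace F]
    {μ : Measure X} [μ.IsAddHaarMeasure] (B : E →L[ℝ] F →L[ℝ] ℝ) (p q : ℝ≥0∞)
    [p.HolderConjugate q] (hq : q ≠ ⊤) {u : X → E} {W : X → F}
    (hu : MemLp u p μ) (hW : MemLp W q μ) {η : X → ℝ} (hη : Continuous η)
    (hηc : HasCompactSupport η) :
    ∫ z, B (u z) (∫ y, η y • W (z - y) ∂μ) ∂μ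
      = ∫ y, (∫ z, B (u z) (W (z - y)) ∂μ) * η y ∂μ := by
  have hWl : LocallyIntegrable W μ := hW.locallyIntegrable (ENNReal.HolderConjugate.one_le q p)
  have h1 : ∀ z, B (u z) (∫ y, η y • W (z - y) ∂μ) = ∫ y, η y * B (u z) (W (z - y)) ∂μ := by
    intro z
    have hex := hηc.convolutionExists_left (ContinuousLinearMap.lsmul ℝ ℝ) hη hWl z
    have := (B (u z)).integral_comp_comm (φ := fun y => η y • W (z - y)) hex
    rw [← this]
    simp
  have hmul : ∀ y, Integrable (fun z => ‖u z‖ * ‖W (z - y)‖) μ := fun y =>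
    hu.norm.integrable_mul
      (hW.norm.comp_measurePreserving (measurePreserving_sub_right μ y))
  have hsm : AEStronglyMeasurable (fun t : X × X => W (t.2 - t.1)) (μ.prod μ) := by
    have := hW.aestronglyMeasurable.comp_quasiMeasurePreserving
      ((quasiMeasurePreserving_sub μ μ).comp (Measure.measurePreserving_swap.quasiMeasurePreserving))
    exact this
  have hint : Integrable (fun t : X × X => η t.1 * B (u t.2) (W (t.2 - t.1))) (μ.prod μ) := by
    have haes : AEStronglyMeasurable (fun t : X × X => η t.1 * B (u t.2) (W (t.2 - t.1)))
        (μ.prod μ) := by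
      refine (hη.comp continuous_fst).aestronglyMeasurable.mul ?_
      exact B.aestronglyMeasurable_comp₂
        (hu.aestronglyMeasurable.comp_snd) hsm
    -- Integrating out `z` leaves the correlation of the norms, which is continuous, times the
    -- compactly supported `‖η‖`.
    have hdom : Integrable (fun t : X × X => (‖B‖ * ‖η t.1‖) * (‖u t.2‖ * ‖W (t.2 - t.1)‖))
        (μ.prod μ) := by
      rw [integrable_prod_iff]
      · refine ⟨Eventually.of_forall fun y => (hmul y).const_mul (‖B‖ * ‖η y‖), ?_⟩
        have hcorr := continuous_integral_correlation (μ := μ)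
          (ContinuousLinearMap.mul ℝ ℝ) p q hq hu.norm hW.norm
        have hcont : Continuous fun y => ‖B‖ * ‖η y‖ * ∫ z, ‖u z‖ * ‖W (z - y)‖ ∂μ :=
          (continuous_const.mul hη.norm).mul hcorr
        have : (fun y => ∫ z, ‖(‖B‖ * ‖η y‖) * (‖u z‖ * ‖W (z - y)‖)‖ ∂μ)
            = fun y => ‖B‖ * ‖η y‖ * ∫ z, ‖u z‖ * ‖W (z - y)‖ ∂μ := by
          ext y
          rw [← integral_const_mul]
          refine integral_congr_ae (Eventually.of_forall fun z => ?_)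
          exact Real.norm_of_nonneg (by positivity)
        simp only
        rw [this]
        refine hcont.integrable_of_hasCompactSupport ?_
        exact (hηc.norm.mul_left (f := fun _ => ‖B‖)).mul_right
      · exact (continuous_const.mul (hη.comp continuous_fst).norm).aestronglyMeasurable.mul
          (hu.aestronglyMeasurable.comp_snd.norm.mul hsm.norm)
    refine hdom.mono' haes (Eventually.of_forall fun t => ?_)
    rw [norm_mul]
    calc ‖η t.1‖ * ‖B (u t.2) (W (t.2 - t.1))‖
        ≤ ‖η t.1‖ * (‖B‖ * ‖u t.2‖ * ‖W (t.2 - t.1)‖) := by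
          gcongr; exact B.le_opNorm₂ _ _
      _ = _ := by ring
  simp_rw [h1]
  rw [← integral_integral_swap hint]
  simp_rw [integral_const_mul, mul_comm (η _)]

/-! ### The Bregman divergence and power inequalities -/

/-- The Bregman divergence of the convex function `s ↦ s ^ (m + 1) / (m + 1)`. -/
noncomputable def bregman (m a b : ℝ) : ℝ := (a ^ (m + 1) - b ^ (m + 1)) / (m + 1) - b ^ m * (a - b)

/-- The difference of the two sides is `a^m ((1 - m) a + m b) - b^m a`, which is nonnegative by
weighted AM-GM, `b^m a^(1-m) ≤ m b + (1 - m) a`, multiplied by `a^m`. -/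
theorem mul_le_bregman {m a b : ℝ} (hm : 0 < m) (hm1 : m < 1) (ha : 0 ≤ a) (hb : 0 ≤ b) :
    m * ((a ^ m - b ^ m) * (a - b)) ≤ (m + 1) * bregman m a b := by
  have h1 : ∀ x : ℝ, 0 ≤ x → x ^ (m + 1) = x ^ m * x := fun x hx => by
    rw [Real.rpow_add_of_nonneg hx hm.le zero_le_one, Real.rpow_one]
  have h3 := Real.geom_mean_le_arith_mean2_weighted (w₁ := m) (w₂ := 1 - m) hm.le (by linarith)
    hb ha (by ring)
  have h4 : a ^ m * a ^ (1 - m) = a := by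
    rw [← Real.rpow_add_of_nonneg ha hm.le (by linarith)]; simp
  have h5 : (m + 1) * bregman m a b = a ^ m * a - b ^ m * b - (m + 1) * (b ^ m * (a - b)) := by
    rw [bregman, h1 a ha, h1 b hb]; field_simp
  rw [h5]
  have h6 := mul_le_mul_of_nonneg_left h3 (Real.rpow_nonneg ha m)
  have h7 : a ^ m * (b ^ m * a ^ (1 - m)) = b ^ m * a := by
    rw [← mul_assoc, mul_comm (a ^ m), mul_assoc, h4]
  nlinarith [h6, h7]

theorem rpow_sub_mul_sub_nonneg {m a b : ℝ} (hm : 0 < m) (ha : 0 ≤ a) (hb : 0 ≤ b) :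
    0 ≤ (a ^ m - b ^ m) * (a - b) := by
  rcases le_total a b with h | h
  · exact mul_nonneg_of_nonpos_of_nonpos
      (sub_nonpos.2 (Real.rpow_le_rpow ha h hm.le)) (sub_nonpos.2 h)
  · exact mul_nonneg (sub_nonneg.2 (Real.rpow_le_rpow hb h hm.le)) (sub_nonneg.2 h)

theorem bregman_nonneg {m a b : ℝ} (hm : 0 < m) (hm1 : m < 1) (ha : 0 ≤ a) (hb : 0 ≤ b) :
    0 ≤ bregman m a b := by
  have h1 := mul_le_bregman hm hm1 ha hb
  have h2 := mul_nonneg hm.le (rpow_sub_mul_sub_nonneg hm ha hb)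
  by_contra! h
  nlinarith

/-- The defect is exactly `bregman m b a ≥ 0` (three-point identity). With `a` and `b` the values of
`u` at two times, this is the discrete substitute for the chain rule `(u^m - c^m) ∂ₜu = ∂ₜF`; only
the inequality is needed. -/
theorem bregman_sub_bregman_le {m a b c : ℝ} (hm : 0 < m) (hm1 : m < 1) (ha : 0 ≤ a)
    (hb : 0 ≤ b) :
    bregman m a c - bregman m b c ≤ (a ^ m - c ^ m) * (a - b) := by
  have h := bregman_nonneg hm hm1 hb ha
  unfold bregman at *
  have : (b ^ (m + 1) - a ^ (m + 1)) / (m + 1) = -((a ^ (m + 1) - b ^ (m + 1)) / (m + 1)) := by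
    ring
  have h2 : (a ^ (m + 1) - c ^ (m + 1)) / (m + 1) - (b ^ (m + 1) - c ^ (m + 1)) / (m + 1)
      = (a ^ (m + 1) - b ^ (m + 1)) / (m + 1) := by ring
  linarith

theorem bregman_le {m a b : ℝ} (hm : 0 < m) (hm1 : m < 1) (ha : 0 ≤ a) (hb : 0 ≤ b) :
    bregman m a b ≤ (a ^ m - b ^ m) * (a - b) := by
  have h := bregman_sub_bregman_le (c := b) hm hm1 ha hb
  have : bregman m b b = 0 := by simp [bregman]
  linarith

/-- Subadditivity of `s ↦ s^m` for `m ≤ 1`. -/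
theorem abs_rpow_sub_rpow_le {m a b : ℝ} (hm : 0 < m) (hm1 : m < 1) (ha : 0 ≤ a) (hb : 0 ≤ b) :
    |a ^ m - b ^ m| ≤ |a - b| ^ m := by
  have key : ∀ x y : ℝ, 0 ≤ y → y ≤ x → x ^ m - y ^ m ≤ (x - y) ^ m := by
    intro x y hy hxy
    have := Real.rpow_add_le_add_rpow hy (sub_nonneg.2 hxy) hm.le hm1.le
    rw [add_sub_cancel] at this
    linarith
  rcases le_total a b with h | h
  · rw [abs_sub_comm, abs_sub_comm a b, abs_of_nonneg (sub_nonneg.2 h),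
      abs_of_nonneg (sub_nonneg.2 (Real.rpow_le_rpow ha h hm.le))]
    exact key b a ha h
  · rw [abs_of_nonneg (sub_nonneg.2 h),
      abs_of_nonneg (sub_nonneg.2 (Real.rpow_le_rpow hb h hm.le))]
    exact key a b hb h

theorem abs_rpow_sub_rpow_rpow_le {m a b : ℝ} (hm : 0 < m) (hm1 : m < 1) (ha : 0 ≤ a)
    (hb : 0 ≤ b) :
    |a ^ m - b ^ m| ^ ((m + 1) / m) ≤ |a ^ m - b ^ m| * |a - b| := by
  have h := abs_rpow_sub_rpow_le hm hm1 ha hb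
  have h1 : (m + 1) / m = 1 + m⁻¹ := by field_simp
  rw [h1, Real.rpow_add_of_nonneg (abs_nonneg _) zero_le_one (by positivity), Real.rpow_one]
  gcongr
  calc |a ^ m - b ^ m| ^ m⁻¹ ≤ (|a - b| ^ m) ^ m⁻¹ := by gcongr
    _ = |a - b| := Real.rpow_rpow_inv (abs_nonneg _) hm.ne'

theorem abs_mul_abs_le_rpow {m a b : ℝ} (hm : 0 < m) (hm1 : m < 1) (ha : 0 ≤ a) (hb : 0 ≤ b) :
    |a ^ m - b ^ m| * |a - b| ≤ |a - b| ^ (m + 1) := by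
  rw [Real.rpow_add_of_nonneg (abs_nonneg _) hm.le zero_le_one, Real.rpow_one]
  gcongr
  exact abs_rpow_sub_rpow_le hm hm1 ha hb

theorem abs_sq_le_rpow {m a b : ℝ} (hm : 0 < m) (hm1 : m < 1) (ha : 0 ≤ a) (hb : 0 ≤ b) :
    |a ^ m - b ^ m| ^ 2 ≤ |a - b| ^ (2 * m) := by
  rw [mul_comm, Real.rpow_mul (abs_nonneg _), Real.rpow_two]
  gcongr
  exact abs_rpow_sub_rpow_le hm hm1 ha hb

/-! ### Measurability of the flux and local integrability of the data -/

/-- `A` is measurable only for the Lebesgue σ-algebra in `z`, so an a.e. change of its arguments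
must come first: with Borel representatives of `u` and `G` the composition is null measurable, hence
a.e. measurable. -/
theorem PME.StructureConditions.aestronglyMeasurable_comp {n : ℕ} {E : Set (Rn n)} {T ν L : ℝ}
    {A : Rn n × ℝ → ℝ → Rn n → Rn n} (hA : StructureConditions E T ν L A)
    {K : Set (Rn n × ℝ)} (hK : K ⊆ spaceTime E T) {u : Rn n × ℝ → ℝ} {G : Rn n × ℝ → Rn n}
    (hu : AEMeasurable u (volume.restrict K)) (hG : AEMeasurable G (volume.restrict K)) :
    AEStronglyMeasurable (fun z => A z (u z) (G z)) (volume.restrict K) := by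
  set μ : Measure (Rn n × ℝ) := volume.restrict (spaceTime E T) with hμ
  have h1 : AEMeasurable (fun z => A z (hu.mk u z) (hG.mk G z)) μ := by
    refine NullMeasurable.aemeasurable (f := fun z => A z (hu.mk u z) (hG.mk G z)) (μ := μ) ?_
    have hm : Measurable (fun z : NullMeasurableSpace (Rn n × ℝ) μ =>
        ((z, (hu.mk u z, hG.mk G z)) : NullMeasurableSpace (Rn n × ℝ) μ × (ℝ × Rn n))) :=
      measurable_id.prodMk ((hu.measurable_mk.nullMeasurable (μ := μ)).measurable'.prodMk
        (hG.measurable_mk.nullMeasurable (μ := μ)).measurable')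
    exact hA.measurable.comp hm
  have h2 : AEMeasurable (fun z => A z (hu.mk u z) (hG.mk G z)) (volume.restrict K) :=
    h1.mono_measure (Measure.restrict_mono hK le_rfl)
  refine (h2.congr ?_).aestronglyMeasurable
  filter_upwards [hu.ae_eq_mk, hG.ae_eq_mk] with z hz1 hz2
  rw [← hz1, ← hz2]

theorem PME.StructureConditions.memLp_comp {n : ℕ} {E : Set (Rn n)} {T ν L : ℝ}
    {A : Rn n × ℝ → ℝ → Rn n → Rn n} (hA : StructureConditions E T ν L A)
    {K : Set (Rn n × ℝ)} (hK : K ⊆ spaceTime E T) {u : Rn n × ℝ → ℝ} {G : Rn n × ℝ → Rn n}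
    (hu : AEMeasurable u (volume.restrict K)) (hG : MemLp G 2 (volume.restrict K)) :
    MemLp (fun z => A z (u z) (G z)) 2 (volume.restrict K) := by
  refine hG.of_le_mul (c := L)
    (hA.aestronglyMeasurable_comp hK hu hG.aestronglyMeasurable.aemeasurable) ?_
  filter_upwards [ae_mono (Measure.restrict_mono hK le_rfl) hA.growth] with z hz using hz _ _

/-- Continuity in time bounds the spatial `L^p` norm near each time, compactness of `Icc a b` makes
the bound uniform, and Tonelli integrates it. -/
theorem PME.MemContTimeLpLoc.memLp_prod {n : ℕ} {E : Set (Rn n)} {T : ℝ} {p : ℝ≥0∞}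
    {u : Rn n × ℝ → ℝ} (hu : MemContTimeLpLoc E T p u) (hp : 1 ≤ p) (hp' : p ≠ ⊤)
    {K : Set (Rn n)} (hK : IsCompact K) (hKE : K ⊆ E) {a b : ℝ} (hab : Icc a b ⊆ Ioo 0 T) :
    MemLp u p (volume.restrict (K ×ˢ Icc a b)) := by
  have hp0 : p ≠ 0 := (zero_lt_one.trans_le hp).ne'
  obtain ⟨C, hC⟩ : ∃ C : NNReal, ∀ t ∈ Icc a b,
      eLpNorm (fun x => u (x, t)) p (volume.restrict K) ≤ C := by
    refine IsCompact.induction_on (p := fun S => ∃ C : NNReal, ∀ t ∈ S,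
      eLpNorm (fun x => u (x, t)) p (volume.restrict K) ≤ C) isCompact_Icc ⟨0, by simp⟩ ?_ ?_ ?_
    · rintro s t hst ⟨C, hC⟩
      exact ⟨C, fun x hx => hC x (hst hx)⟩
    · rintro s t ⟨C, hC⟩ ⟨D, hD⟩
      refine ⟨max C D, ?_⟩
      rintro x (hx | hx)
      · exact (hC x hx).trans (by simp)
      · exact (hD x hx).trans (by simp)
    · intro t₀ ht₀
      have hev := (hu.continuous K hK hKE t₀ (hab ht₀)).eventually (gt_mem_nhds one_pos)
      have hm0 := hu.memLpLoc t₀ (hab ht₀) K hK hKE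
      refine ⟨_, mem_nhdsWithin_of_mem_nhds (hev.and (isOpen_Ioo.mem_nhds (hab ht₀))),
        (eLpNorm (fun x => u (x, t₀)) p (volume.restrict K)).toNNReal + 1, ?_⟩
      rintro t ⟨ht, htT⟩
      have hmt := hu.memLpLoc t htT K hK hKE
      have h1 : (fun x => u (x, t)) = (fun x => u (x, t) - u (x, t₀)) + fun x => u (x, t₀) := by
        ext x; simp
      rw [h1]
      refine (eLpNorm_add_le (hmt.1.sub hm0.1) hm0.1 hp).trans ?_
      rw [add_comm]
      push_cast
      rw [ENNReal.coe_toNNReal hm0.2.ne]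
      gcongr
      exact ht.le
  have hsub : K ×ˢ Icc a b ⊆ spaceTime E T := prod_mono hKE hab
  have hm := hu.aestronglyMeasurable.mono_measure (Measure.restrict_mono hsub le_rfl)
  refine ⟨hm, ?_⟩
  rw [eLpNorm_lt_top_iff_lintegral_rpow_enorm_lt_top hp0 hp']
  have hprod : (volume.restrict (K ×ˢ Icc a b) : Measure (Rn n × ℝ))
      = (volume.restrict K).prod (volume.restrict (Icc a b)) := by
    rw [Measure.prod_restrict]; rfl
  rw [hprod] at hm ⊢
  rw [lintegral_prod_symm _ (hm.aemeasurable.enorm.pow_const _)]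
  have hbd : ∀ t ∈ Icc a b, ∫⁻ x, ‖u (x, t)‖ₑ ^ p.toReal ∂(volume.restrict K)
      ≤ (C : ℝ≥0∞) ^ p.toReal := by
    intro t ht
    have h1 := hC t ht
    rw [eLpNorm_eq_lintegral_rpow_enorm_toReal hp0 hp'] at h1
    have hpos : 0 < p.toReal := ENNReal.toReal_pos hp0 hp'
    calc _ = ((∫⁻ x, ‖u (x, t)‖ₑ ^ p.toReal ∂(volume.restrict K)) ^ (1 / p.toReal)) ^ p.toReal := by
            rw [← ENNReal.rpow_mul, one_div_mul_cancel hpos.ne', ENNReal.rpow_one]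
      _ ≤ _ := by gcongr
  calc ∫⁻ t in Icc a b, ∫⁻ x, ‖u (x, t)‖ₑ ^ p.toReal ∂(volume.restrict K)
      ≤ ∫⁻ t in Icc a b, (C : ℝ≥0∞) ^ p.toReal := setLIntegral_mono' measurableSet_Icc hbd
    _ < ⊤ := by
      rw [setLIntegral_const]
      exact ENNReal.mul_lt_top (ENNReal.rpow_lt_top_of_nonneg (by positivity) (by simp))
        (by simp)

theorem memLp_of_norm_le_on_compact {X F F' : Type*} [TopologicalSpace X] [T2Space X]
    [MeasurableSpace X] [BorelSpace X] [NormedAddCommGroup F]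
    [NormedAddCommGroup F'] {μ : Measure X} {K : Set X} (hK : IsCompact K) {p : ℝ≥0∞}
    {f : X → F} {h : X → F'} (hf : MemLp f p (μ.restrict K))
    (hm : AEStronglyMeasurable h (μ.restrict K)) {C : ℝ} (hC : ∀ z ∈ K, ‖h z‖ ≤ C * ‖f z‖)
    (h0 : ∀ z ∉ K, h z = 0) : MemLp h p μ := by
  have h1 : MemLp h p (μ.restrict K) := hf.of_le_mul (c := C) hm
    (ae_restrict_of_forall_mem hK.measurableSet hC)
  have h2 : K.indicator h = h := by
    ext z; by_cases hz : z ∈ K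
    · simp [hz]
    · simp [hz, h0 z hz]
  rw [← h2]
  exact (memLp_indicator_iff_restrict hK.measurableSet).2 h1

theorem memLp_continuous_smul {X F : Type*} [TopologicalSpace X] [T2Space X]
    [MeasurableSpace X] [BorelSpace X] [NormedAddCommGroup F] [NormedSpace ℝ F]
    {μ : Measure X} {K : Set X} (hK : IsCompact K) {p : ℝ≥0∞}
    {f : X → F} {g : X → ℝ} (hf : MemLp f p (μ.restrict K)) (hg : Continuous g)
    (h0 : ∀ z ∉ K, g z = 0) : MemLp (fun z => g z • f z) p μ := by
  obtain ⟨C, hC⟩ := hK.exists_bound_of_continuousOn hg.continuousOn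
  refine memLp_of_norm_le_on_compact hK hf (hg.measurable.aestronglyMeasurable.smul hf.1) (C := C) ?_ ?_
  · intro z hz
    rw [norm_smul]
    gcongr
    exact hC z hz
  · intro z hz; simp [h0 z hz]

theorem memLp_smul_continuous {X F : Type*} [TopologicalSpace X] [T2Space X]
    [MeasurableSpace X] [BorelSpace X] [NormedAddCommGroup F] [NormedSpace ℝ F]
    [MeasurableSpace F] [BorelSpace F] [SecondCountableTopology F]
    {μ : Measure X} {K : Set X} (hK : IsCompact K) {p : ℝ≥0∞}
    {f : X → ℝ} {g : X → F} (hf : MemLp f p (μ.restrict K)) (hg : Continuous g)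
    (h0 : ∀ z ∉ K, g z = 0) : MemLp (fun z => f z • g z) p μ := by
  obtain ⟨C, hC⟩ := hK.exists_bound_of_continuousOn hg.continuousOn
  refine memLp_of_norm_le_on_compact hK hf (hf.1.smul hg.measurable.aestronglyMeasurable) (C := C) ?_ ?_
  · intro z hz
    rw [norm_smul, mul_comm]
    gcongr
    exact hC z hz
  · intro z hz; simp [h0 z hz]

/-! ### Gradients and the weak product rule -/

section Gradient

variable {V : Type*} [NormedAddCommGroup V] [InnerProductSpace ℝ V] [CompleteSpace V]

theorem continuous_gradient {g : V → ℝ} (hg : ContDiff ℝ 1 g) : Continuous (gradient g) :=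
  (InnerProductSpace.toDual ℝ V).symm.continuous.comp (hg.continuous_fderiv one_ne_zero)

theorem gradient_eq_zero_of_notMem_tsupport {g : V → ℝ} {x : V} (hx : x ∉ tsupport g) :
    gradient g x = 0 := by
  simp [gradient, fderiv_of_notMem_tsupport ℝ hx]

theorem gradient_fun_mul {f g : V → ℝ} {x : V} (hf : DifferentiableAt ℝ f x)
    (hg : DifferentiableAt ℝ g x) :
    gradient (fun y => f y * g y) x = f x • gradient g x + g x • gradient f x := by
  simp [gradient, fderiv_fun_mul hf hg]

theorem integral_gradient_eq_zero [FiniteDimensional ℝ V] [MeasurableSpace V] [BorelSpace V]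
    {μ : Measure V} [μ.IsAddHaarMeasure] {g : V → ℝ} (hg : ContDiff ℝ 1 g)
    (hc : HasCompactSupport g) : ∫ x, gradient g x ∂μ = 0 := by
  have hcg : HasCompactSupport (gradient g) :=
    hc.mono' fun x hx => by_contra fun h => hx (gradient_eq_zero_of_notMem_tsupport h)
  have hi : Integrable (gradient g) μ := (continuous_gradient hg).integrable_of_hasCompactSupport hcg
  refine ext_inner_left ℝ fun v => ?_
  have hiv : Integrable (fun x => fderiv ℝ g x v) μ :=
    ((hg.continuous_fderiv one_ne_zero).clm_apply continuous_const).integrable_of_hasCompactSupport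
      ((hc.fderiv ℝ).comp_left (g := fun D : V →L[ℝ] ℝ => D v) (by simp))
  have h1 := integral_mul_fderiv_eq_neg_fderiv_mul_of_integrable (μ := μ) (f := fun _ : V => (1 : ℝ))
    (g := g) (v := v) (by simp) (by simpa using hiv)
    (by simpa using hg.continuous.integrable_of_hasCompactSupport hc)
    (fun _ _ => differentiableAt_const _) (fun x _ => hg.differentiable one_ne_zero x)
  rw [← integral_inner hi v]
  simpa using h1

end Gradient

/-- Leibniz rule for the weak gradient of `ψ (w - k)`, extended by zero to the whole space: test
with `ψ Φ`, which is supported in `U` whatever the support of `Φ`. The constant `k` costs nothing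
since the gradient of `ψ Φ` has integral zero. -/
theorem PME.HasWeakGradientOn.integral_cutoff {n : ℕ} {U : Set (Rn n)} {w : Rn n → ℝ}
    {g : Rn n → Rn n} (h : HasWeakGradientOn U w g) {ψ Φ : Rn n → ℝ}
    (hψ : IsTestFunction U ψ) (hΦ : ContDiff ℝ ∞ Φ) (k : ℝ) :
    ∫ x, (ψ x * (w x - k)) • gradient Φ x
      = - ∫ x, Φ x • (ψ x • g x + (w x - k) • gradient ψ x) := by
  have hK : IsCompact (tsupport ψ) := hψ.hasCompactSupport
  have hw := h.memLpLoc _ hK hψ.tsupport_subset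
  have hg := h.memLpLoc_grad _ hK hψ.tsupport_subset
  have : IsFiniteMeasure (volume.restrict (tsupport ψ)) :=
    ⟨by simpa using hK.measure_lt_top⟩
  have hwk : MemLp (fun x => w x - k) 1 (volume.restrict (tsupport ψ)) :=
    hw.sub (memLp_const k)
  have hψ1 : ContDiff ℝ 1 ψ := hψ.contDiff.of_le (by simp)
  have hΦ1 : ContDiff ℝ 1 Φ := hΦ.of_le (by simp)
  have hψ0 : ∀ x ∉ tsupport ψ, ψ x = 0 := fun x hx => image_eq_zero_of_notMem_tsupport hx
  have hgψ0 : ∀ x ∉ tsupport ψ, gradient ψ x = 0 := fun x hx =>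
    gradient_eq_zero_of_notMem_tsupport hx
  have htest : IsTestFunction U (fun x => ψ x * Φ x) :=
    ⟨hψ.contDiff.mul hΦ, hψ.hasCompactSupport.mul_right,
      (tsupport_mul_subset_left (f := ψ) (g := Φ)).trans hψ.tsupport_subset⟩
  have htc : HasCompactSupport (fun x => ψ x * Φ x) := htest.hasCompactSupport
  have hgp : ∀ x, gradient (fun x => ψ x * Φ x) x = ψ x • gradient Φ x + Φ x • gradient ψ x :=
    fun x => gradient_fun_mul (hψ1.differentiable one_ne_zero x)
      (hΦ1.differentiable one_ne_zero x)
  have hi1 : Integrable (fun x => (w x - k) • (ψ x • gradient Φ x)) :=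
    memLp_one_iff_integrable.1 (memLp_smul_continuous hK hwk
      (hψ1.continuous.smul (continuous_gradient hΦ1)) fun x hx => by simp [hψ0 x hx])
  have hi2 : Integrable (fun x => (w x - k) • (Φ x • gradient ψ x)) :=
    memLp_one_iff_integrable.1 (memLp_smul_continuous hK hwk
      (hΦ1.continuous.smul (continuous_gradient hψ1)) fun x hx => by simp [hgψ0 x hx])
  have hi3 : Integrable (fun x => (ψ x * Φ x) • g x) :=
    memLp_one_iff_integrable.1 (memLp_continuous_smul hK hg
      (hψ1.continuous.mul hΦ1.continuous) fun x hx => by simp [hψ0 x hx])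
  have hcg : Continuous (gradient fun x => ψ x * Φ x) := continuous_gradient (hψ1.mul hΦ1)
  have hg0 : ∀ x ∉ tsupport ψ, gradient (fun x => ψ x * Φ x) x = 0 := fun x hx => by
    rw [hgp, hψ0 x hx, hgψ0 x hx]; simp
  have hi4 : Integrable (fun x => w x • gradient (fun x => ψ x * Φ x) x) :=
    memLp_one_iff_integrable.1 (memLp_smul_continuous hK hw hcg hg0)
  have hi5 : Integrable (fun x => k • gradient (fun x => ψ x * Φ x) x) :=
    memLp_one_iff_integrable.1 (memLp_smul_continuous hK (memLp_const k) hcg hg0)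
  have hmain := h.integral_eq _ htest
  have hnotU : ∀ x ∉ U, x ∉ tsupport ψ := fun x hx hx' => hx (hψ.tsupport_subset hx')
  rw [setIntegral_eq_integral_of_forall_compl_eq_zero
      (fun x hx => by rw [hg0 x (hnotU x hx), smul_zero]),
    setIntegral_eq_integral_of_forall_compl_eq_zero
      (fun x hx => by simp [hψ0 x (hnotU x hx)])] at hmain
  have hk : ∫ x, k • gradient (fun x => ψ x * Φ x) x = 0 := by
    rw [integral_smul, integral_gradient_eq_zero (hψ1.mul hΦ1) htc, smul_zero]
  have hsum : ∫ x, ((w x - k) • (ψ x • gradient Φ x) + (w x - k) • (Φ x • gradient ψ x))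
      = - ∫ x, (ψ x * Φ x) • g x := by
    rw [← hmain, ← sub_zero (∫ x, w x • _), ← hk, ← integral_sub hi4 hi5]
    refine integral_congr_ae (Eventually.of_forall fun x => ?_)
    simp only [hgp]
    module
  rw [integral_add hi1 hi2] at hsum
  have e1 : ∫ x, (ψ x * (w x - k)) • gradient Φ x = ∫ x, (w x - k) • (ψ x • gradient Φ x) :=
    integral_congr_ae (Eventually.of_forall fun x => by simp only; module)
  have e2 : ∫ x, Φ x • (ψ x • g x + (w x - k) • gradient ψ x)
      = ∫ x, ((ψ x * Φ x) • g x + (w x - k) • (Φ x • gradient ψ x)) :=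
    integral_congr_ae (Eventually.of_forall fun x => by simp only; module)
  rw [e1, e2, integral_add hi3 hi2, neg_add, ← hsum]
  abel

theorem gradient_slice {n : ℕ} {φ : Rn n × ℝ → ℝ} {z : Rn n × ℝ} (h : DifferentiableAt ℝ φ z)
    (v : Rn n) : inner ℝ v (gradient (fun x => φ (x, z.2)) z.1) = fderiv ℝ φ z (v, 0) := by
  rw [inner_gradient_right]
  have h1 : HasFDerivAt φ (fderiv ℝ φ z) (z.1, z.2) := h.hasFDerivAt
  have h2 := (HasFDerivAt.comp (f := fun x => (x, z.2)) z.1 h1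
    (hasFDerivAt_prodMk_left z.1 z.2)).fderiv
  simp only [Function.comp_def] at h2
  rw [h2]; simp

theorem deriv_slice {n : ℕ} {φ : Rn n × ℝ → ℝ} {z : Rn n × ℝ} (h : DifferentiableAt ℝ φ z) :
    deriv (fun t => φ (z.1, t)) z.2 = fderiv ℝ φ z (0, 1) := by
  have h1 : HasFDerivAt φ (fderiv ℝ φ z) (z.1, z.2) := h.hasFDerivAt
  have h2 := (HasFDerivAt.comp (f := fun t => (z.1, t)) z.2 h1
    (hasFDerivAt_prodMk_right z.1 z.2)).hasDerivAt.deriv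
  simp only [Function.comp_def] at h2
  rw [h2]; simp

theorem gradient_slice_eq {n : ℕ} {φ : Rn n × ℝ → ℝ} (h : Differentiable ℝ φ) (z : Rn n × ℝ) :
    gradient (fun x => φ (x, z.2)) z.1 = (InnerProductSpace.toDual ℝ (Rn n)).symm
      ((fderiv ℝ φ z).comp (ContinuousLinearMap.inl ℝ (Rn n) ℝ)) := by
  refine ext_inner_left ℝ fun v => ?_
  rw [gradient_slice (h z), real_inner_comm, InnerProductSpace.toDual_symm_apply]
  simp

theorem continuous_gradient_slice {n : ℕ} {φ : Rn n × ℝ → ℝ} (h : ContDiff ℝ 1 φ) :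
    Continuous fun z : Rn n × ℝ => gradient (fun x => φ (x, z.2)) z.1 := by
  simp_rw [gradient_slice_eq (h.differentiable one_ne_zero)]
  exact (InnerProductSpace.toDual ℝ (Rn n)).symm.continuous.comp
    ((h.continuous_fderiv one_ne_zero).clm_comp continuous_const)

/-! ### The space-time truncation and its weak gradient -/

/-- The truncation `χ(t) ψ(x) (w(x, t) - k)`. -/
noncomputable def cutoffFun {n : ℕ} (χ : ℝ → ℝ) (ψ : Rn n → ℝ) (k : ℝ) (w : Rn n × ℝ → ℝ)
    (z : Rn n × ℝ) : ℝ := χ z.2 * (ψ z.1 * (w z - k))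

/-- The weak spatial gradient of `χ(t) ψ(x) (w(x, t) - k)` when `Dw = G`. -/
noncomputable def cutoffGrad {n : ℕ} (χ : ℝ → ℝ) (ψ : Rn n → ℝ) (k : ℝ) (w : Rn n × ℝ → ℝ)
    (G : Rn n × ℝ → Rn n) (z : Rn n × ℝ) : Rn n :=
  χ z.2 • (ψ z.1 • G z + (w z - k) • gradient ψ z.1)

theorem memLp_cutoffFun {n : ℕ} {χ : ℝ → ℝ} {ψ : Rn n → ℝ} {k : ℝ} {w : Rn n × ℝ → ℝ}
    (hχ : Continuous χ) (hχc : HasCompactSupport χ) (hψ : Continuous ψ)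
    (hψc : HasCompactSupport ψ) {p : ℝ≥0∞}
    (hw : MemLp w p (volume.restrict (tsupport ψ ×ˢ tsupport χ))) :
    MemLp (cutoffFun χ ψ k w) p := by
  have hK : IsCompact (tsupport ψ ×ˢ tsupport χ) :=
    IsCompact.prod (show IsCompact (tsupport ψ) from hψc) hχc
  have : IsFiniteMeasure ((volume : Measure (Rn n × ℝ)).restrict (tsupport ψ ×ˢ tsupport χ)) :=
    ⟨by simpa using hK.measure_lt_top⟩
  have := memLp_continuous_smul hK (hw.sub (memLp_const k))
    (g := fun z => χ z.2 * ψ z.1) (by fun_prop) (by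
      intro z hz
      rw [mem_prod, not_and_or] at hz
      rcases hz with hz | hz
      · simp [image_eq_zero_of_notMem_tsupport hz]
      · simp [image_eq_zero_of_notMem_tsupport hz])
  refine (memLp_congr_ae (Eventually.of_forall fun z => ?_)).1 this
  simp [cutoffFun, mul_assoc]

theorem memLp_cutoffGrad {n : ℕ} {χ : ℝ → ℝ} {ψ : Rn n → ℝ} {k : ℝ} {w : Rn n × ℝ → ℝ}
    {G : Rn n × ℝ → Rn n}
    (hχ : Continuous χ) (hχc : HasCompactSupport χ) (hψ : ContDiff ℝ 1 ψ)
    (hψc : HasCompactSupport ψ) {p : ℝ≥0∞}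
    (hw : MemLp w p (volume.restrict (tsupport ψ ×ˢ tsupport χ)))
    (hG : MemLp G p (volume.restrict (tsupport ψ ×ˢ tsupport χ))) :
    MemLp (cutoffGrad χ ψ k w G) p := by
  have hK : IsCompact (tsupport ψ ×ˢ tsupport χ) :=
    IsCompact.prod (show IsCompact (tsupport ψ) from hψc) hχc
  have : IsFiniteMeasure ((volume : Measure (Rn n × ℝ)).restrict (tsupport ψ ×ˢ tsupport χ)) :=
    ⟨by simpa using hK.measure_lt_top⟩
  have hψ' := hψ.continuous
  have h1 := memLp_continuous_smul hK hG
    (g := fun z => χ z.2 * ψ z.1) (by fun_prop) (by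
      intro z hz
      rw [mem_prod, not_and_or] at hz
      rcases hz with hz | hz
      · simp [image_eq_zero_of_notMem_tsupport hz]
      · simp [image_eq_zero_of_notMem_tsupport hz])
  have h2 := memLp_smul_continuous hK (hw.sub (memLp_const k))
    (g := fun z : Rn n × ℝ => χ z.2 • gradient ψ z.1)
    ((hχ.comp continuous_snd).smul ((continuous_gradient hψ).comp continuous_fst)) (by
      intro z hz
      rw [mem_prod, not_and_or] at hz
      rcases hz with hz | hz
      · simp [gradient_eq_zero_of_notMem_tsupport hz]
      · simp [image_eq_zero_of_notMem_tsupport hz])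
  refine (memLp_congr_ae (Eventually.of_forall fun z => ?_)).1 (h1.add h2)
  simp only [cutoffGrad, Pi.add_apply, Pi.sub_apply]
  module

/-- The spatial Leibniz rule holds on almost every time slice in `(0, T)`, and `χ` vanishes on all
other slices; Fubini assembles them. -/
theorem PME.MemL2W12LocWithGradient.integral_cutoffFun_smul_gradient {n : ℕ} {E : Set (Rn n)}
    {T : ℝ} {w : Rn n × ℝ → ℝ} {G : Rn n × ℝ → Rn n} (h : MemL2W12LocWithGradient E T w G)
    {χ : ℝ → ℝ} {ψ : Rn n → ℝ} (hχ : Continuous χ) (hχc : HasCompactSupport χ)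
    (hχT : tsupport χ ⊆ Ioo 0 T) (hψ : IsTestFunction E ψ) (k : ℝ) {φ : Rn n × ℝ → ℝ}
    (hφ : ContDiff ℝ ∞ φ) (hφc : HasCompactSupport φ) :
    ∫ z, cutoffFun χ ψ k w z • gradient (fun x => φ (x, z.2)) z.1
      = - ∫ z, φ z • cutoffGrad χ ψ k w G z := by
  have hφ1 : ContDiff ℝ 1 φ := hφ.of_le (by simp)
  have hψ1 : ContDiff ℝ 1 ψ := hψ.contDiff.of_le (by simp)
  have hK : IsCompact (tsupport ψ ×ˢ tsupport χ) :=
    IsCompact.prod (show IsCompact (tsupport ψ) from hψ.hasCompactSupport) hχc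
  have hKE : tsupport ψ ×ˢ tsupport χ ⊆ spaceTime E T := prod_mono hψ.tsupport_subset hχT
  have hW := memLp_cutoffFun (k := k) hχ hχc hψ.contDiff.continuous hψ.hasCompactSupport
    (h.memLpLoc _ hK hKE)
  have hH := memLp_cutoffGrad (k := k) hχ hχc hψ1 hψ.hasCompactSupport
    (h.memLpLoc _ hK hKE) (h.memLpLoc_grad _ hK hKE)
  have hgc : HasCompactSupport fun z : Rn n × ℝ => gradient (fun x => φ (x, z.2)) z.1 := by
    simp_rw [gradient_slice_eq (hφ1.differentiable one_ne_zero)]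
    exact (hφc.fderiv ℝ).comp_left
      (g := fun D : Rn n × ℝ →L[ℝ] ℝ => (InnerProductSpace.toDual ℝ (Rn n)).symm
        (D.comp (ContinuousLinearMap.inl ℝ (Rn n) ℝ))) (by simp)
  have hi1 := (hW.locallyIntegrable (by norm_num)).integrable_smul_right_of_hasCompactSupport
    (continuous_gradient_slice hφ1) hgc
  have hi2 := (hH.locallyIntegrable (by norm_num)).integrable_smul_left_of_hasCompactSupport
    hφ.continuous hφc
  rw [Measure.volume_eq_prod, integral_prod_symm _ hi1, integral_prod_symm _ hi2, ← integral_neg]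
  refine integral_congr_ae ?_
  filter_upwards [(ae_restrict_iff' measurableSet_Ioo).1 h.weakGradient] with t ht
  by_cases htT : t ∈ Ioo 0 T
  · have h1 := (ht htT).integral_cutoff hψ (Φ := fun x => φ (x, t))
      (hφ.comp (contDiff_id.prodMk contDiff_const)) k
    have e1 : ∀ x, cutoffFun χ ψ k w (x, t) • gradient (fun x => φ (x, t)) x
        = χ t • ((ψ x * (w (x, t) - k)) • gradient (fun x => φ (x, t)) x) := fun x => by
      simp only [cutoffFun, smul_smul]
    have e2 : ∀ x, φ (x, t) • cutoffGrad χ ψ k w G (x, t)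
        = χ t • (φ (x, t) • (ψ x • G (x, t) + (w (x, t) - k) • gradient ψ x)) := fun x => by
      simp only [cutoffGrad]; module
    simp only [e1, e2, integral_smul, h1, smul_neg]
  · have : χ t = 0 := image_eq_zero_of_notMem_tsupport fun h => htT (hχT h)
    simp [cutoffFun, cutoffGrad, this]

instance isAddHaarMeasure_volume_spaceTime (n : ℕ) :
    (volume : Measure (Rn n × ℝ)).IsAddHaarMeasure :=
  inferInstanceAs (((volume : Measure (Rn n)).prod (volume : Measure ℝ)).IsAddHaarMeasure)

theorem integrable_bilin {X E F : Type*} [MeasurableSpace X] {μ : Measure X}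
    [NormedAddCommGroup E] [NormedSpace ℝ E] [NormedAddCommGroup F] [NormedSpace ℝ F]
    (B : E →L[ℝ] F →L[ℝ] ℝ) (p q : ℝ≥0∞) [p.HolderConjugate q] {u : X → E} {W : X → F}
    (hu : MemLp u p μ) (hW : MemLp W q μ) : Integrable (fun z => B (u z) (W z)) μ := by
  refine ((hu.norm.integrable_mul hW.norm).const_mul ‖B‖).mono'
    (B.aestronglyMeasurable_comp₂ hu.1 hW.1) (Eventually.of_forall fun z => ?_)
  simpa [mul_assoc] using B.le_opNorm₂ (u z) (W z)

/-- The real inner product as a continuous bilinear map. -/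
noncomputable def innerCLM (V : Type*) [NormedAddCommGroup V] [InnerProductSpace ℝ V] :
    V →L[ℝ] V →L[ℝ] ℝ :=
  (isBoundedBilinearMap_inner (𝕜 := ℝ) (E := V)).toContinuousLinearMap

@[simp]
theorem innerCLM_apply {V : Type*} [NormedAddCommGroup V] [InnerProductSpace ℝ V] (x y : V) :
    innerCLM V x y = inner ℝ x y := rfl

open scoped Convolution in
theorem contDiff_smul_convolution {X : Type*} [NormedAddCommGroup X] [NormedSpace ℝ X]
    [FiniteDimensional ℝ X] [MeasurableSpace X] [BorelSpace X]
    {μ : Measure X} [μ.IsAddHaarMeasure] {η : X → ℝ} {g : X → ℝ} (hη : ContDiff ℝ ∞ η)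
    (hηc : HasCompactSupport η) (hg : LocallyIntegrable g μ) :
    ContDiff ℝ ∞ (fun z => ∫ y, η y • g (z - y) ∂μ) :=
  hηc.contDiff_convolution_left (ContinuousLinearMap.lsmul ℝ ℝ) hη hg

theorem holderConjugate_ofReal {m : ℝ} (hm : 0 < m) :
    (ENNReal.ofReal (m + 1)).HolderConjugate (ENNReal.ofReal ((m + 1) / m)) := by
  refine Real.HolderConjugate.ennrealOfReal ?_
  rw [Real.holderConjugate_iff]
  refine ⟨by linarith, ?_⟩
  field_simp
  ring

theorem memLp_rpow {X : Type*} [MeasurableSpace X] {μ : Measure X} {m : ℝ} (hm : 0 < m)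
    {u : X → ℝ} (hu : MemLp u (ENNReal.ofReal (m + 1)) μ) (h0 : ∀ᵐ z ∂μ, 0 ≤ u z) :
    MemLp (fun z => u z ^ m) (ENNReal.ofReal ((m + 1) / m)) μ := by
  have h := hu.norm_rpow_div (ENNReal.ofReal m)
  rw [← ENNReal.ofReal_div_of_pos hm, ENNReal.toReal_ofReal hm.le] at h
  refine (memLp_congr_ae ?_).1 h
  filter_upwards [h0] with z hz
  rw [Real.norm_of_nonneg hz]

theorem cutoffFun_eq_zero {n : ℕ} {χ : ℝ → ℝ} {ψ : Rn n → ℝ} {k : ℝ} {w : Rn n × ℝ → ℝ}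
    {z : Rn n × ℝ} (hz : z ∉ tsupport ψ ×ˢ tsupport χ) : cutoffFun χ ψ k w z = 0 := by
  rw [mem_prod, not_and_or] at hz
  rcases hz with hz | hz
  · simp [cutoffFun, image_eq_zero_of_notMem_tsupport hz]
  · simp [cutoffFun, image_eq_zero_of_notMem_tsupport hz]

/-! ### Mollified test functions and the time derivative of the correlation -/

/-- The mollification of `χ ψ (w - k)` as a test function, with its derivatives. -/
theorem PME.MemL2W12LocWithGradient.mollification {n : ℕ} {E : Set (Rn n)}
    {T : ℝ} {w : Rn n × ℝ → ℝ} {G : Rn n × ℝ → Rn n} (h : MemL2W12LocWithGradient E T w G)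
    {χ : ℝ → ℝ} {ψ : Rn n → ℝ} (hχ : Continuous χ) (hχc : HasCompactSupport χ)
    (hχT : tsupport χ ⊆ Ioo 0 T) (hψ : IsTestFunction E ψ) (k : ℝ)
    {K : Set (Rn n × ℝ)} (hK : IsCompact K) (hKE : K ⊆ spaceTime E T) {r : ℝ}
    (hKr : ∀ z ∈ tsupport ψ ×ˢ tsupport χ, ∀ y, ‖y‖ < r → z + y ∈ K)
    {η : Rn n × ℝ → ℝ} (hη : ContDiff ℝ ∞ η) (hηc : HasCompactSupport η)
    (hηr : tsupport η ⊆ Metric.ball 0 r) {φ : Rn n × ℝ → ℝ}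
    (hφdef : φ = fun z => ∫ y, η y • cutoffFun χ ψ k w (z - y)) :
    IsTestFunction (spaceTime E T) φ ∧ tsupport φ ⊆ K ∧
      (∀ z, deriv (fun t => φ (z.1, t)) z.2
        = ∫ y, fderiv ℝ η y (0, 1) • cutoffFun χ ψ k w (z - y)) ∧
      ∀ z, gradient (fun x => φ (x, z.2)) z.1 = ∫ y, η y • cutoffGrad χ ψ k w G (z - y) := by
  have hψ1 : ContDiff ℝ 1 ψ := hψ.contDiff.of_le (by simp)
  have hS : IsCompact (tsupport ψ ×ˢ tsupport χ) :=
    IsCompact.prod (show IsCompact (tsupport ψ) from hψ.hasCompactSupport) hχc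
  have hSE : tsupport ψ ×ˢ tsupport χ ⊆ spaceTime E T := prod_mono hψ.tsupport_subset hχT
  have hW := memLp_cutoffFun (k := k) hχ hχc hψ.contDiff.continuous hψ.hasCompactSupport
    (h.memLpLoc _ hS hSE)
  have hH := memLp_cutoffGrad (k := k) hχ hχc hψ1 hψ.hasCompactSupport
    (h.memLpLoc _ hS hSE) (h.memLpLoc_grad _ hS hSE)
  have hWl : LocallyIntegrable (cutoffFun χ ψ k w) := hW.locallyIntegrable (by norm_num)
  have hHl : LocallyIntegrable (cutoffGrad χ ψ k w G) := hH.locallyIntegrable (by norm_num)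
  have hφ : ContDiff ℝ ∞ φ := by
    rw [hφdef]; exact contDiff_smul_convolution hη hηc hWl
  have hφd : Differentiable ℝ φ := hφ.differentiable (by simp)
  have hsupp : tsupport φ ⊆ K := by
    refine closure_minimal ?_ hK.isClosed
    intro z hz
    by_contra hzK
    refine hz ?_
    rw [hφdef]
    refine integral_eq_zero_of_ae (Eventually.of_forall fun y => ?_)
    by_cases hy : y ∈ tsupport η
    · have : z - y ∉ tsupport ψ ×ˢ tsupport χ := fun h' => hzK (by
        have := hKr _ h' y (by simpa using hηr hy)
        simpa using this)
      simp [cutoffFun_eq_zero this]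
    · simp [image_eq_zero_of_notMem_tsupport hy]
  have hfd : ∀ z e, fderiv ℝ φ z e = ∫ y, fderiv ℝ η y e • cutoffFun χ ψ k w (z - y) := by
    intro z e
    obtain ⟨D, hD, hDe⟩ := hasFDerivAt_smul_convolution (μ := (volume : Measure (Rn n × ℝ)))
      (hη.of_le (by simp)) hηc hWl z
    rw [← hφdef] at hD
    rw [hD.fderiv, hDe]
  refine ⟨⟨hφ, hK.of_isClosed_subset (isClosed_tsupport _) hsupp, hsupp.trans hKE⟩, hsupp,
    fun z => by rw [deriv_slice (hφd z), hfd], fun z => ?_⟩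
  -- Testing the weak gradient identity with the reflected kernel moves the spatial derivative from
  -- `η` onto the truncation.
  set φ' : Rn n × ℝ → ℝ := fun y => η (z - y) with hφ'
  have hφ's : ContDiff ℝ ∞ φ' := by fun_prop
  have hφ'c : HasCompactSupport φ' := hηc.comp_homeomorph (Homeomorph.subLeft z)
  have hφ'd : ∀ y e, fderiv ℝ φ' y e = - fderiv ℝ η (z - y) e := by
    intro y e
    have hd : HasFDerivAt η (fderiv ℝ η (z - y)) (z - y) :=
      (hη.differentiable (by simp)).differentiableAt.hasFDerivAt
    have := HasFDerivAt.comp y hd ((hasFDerivAt_id y).const_sub z)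
    have h3 := this.fderiv
    simp only [Function.comp_def] at h3
    rw [hφ', h3]; simp
  have key := h.integral_cutoffFun_smul_gradient hχ hχc hχT hψ k hφ's hφ'c
  have hφ'1 : ContDiff ℝ 1 φ' := hφ's.of_le (by simp)
  have hgc : HasCompactSupport fun z : Rn n × ℝ => gradient (fun x => φ' (x, z.2)) z.1 := by
    simp_rw [gradient_slice_eq (hφ'1.differentiable one_ne_zero)]
    exact (hφ'c.fderiv ℝ).comp_left
      (g := fun D : Rn n × ℝ →L[ℝ] ℝ => (InnerProductSpace.toDual ℝ (Rn n)).symm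
        (D.comp (ContinuousLinearMap.inl ℝ (Rn n) ℝ))) (by simp)
  have hi1 := hWl.integrable_smul_right_of_hasCompactSupport
    (continuous_gradient_slice hφ'1) hgc
  refine ext_inner_left ℝ fun v => ?_
  rw [gradient_slice (hφd z), hfd]
  have e1 : ∫ y, η y • cutoffGrad χ ψ k w G (z - y) = ∫ y, φ' y • cutoffGrad χ ψ k w G y := by
    rw [← integral_sub_left_eq_self _ volume z]
    simp [hφ']
  have e2 : ∫ y, fderiv ℝ η y (v, 0) • cutoffFun χ ψ k w (z - y)
      = - ∫ y, inner ℝ v (cutoffFun χ ψ k w y • gradient (fun x => φ' (x, y.2)) y.1) := by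
    rw [← integral_sub_left_eq_self _ volume z, ← integral_neg]
    refine integral_congr_ae (Eventually.of_forall fun y => ?_)
    simp only [sub_sub_cancel]
    rw [inner_smul_right, gradient_slice (hφ'1.differentiable one_ne_zero y), hφ'd]
    simp [mul_comm]
  rw [e1, e2, integral_inner hi1, key, inner_neg_right, neg_neg]

/-- The time correlation of `u` with the truncation `χ ψ (u ^ m - k)` is differentiable, and the
weak formulation gives its derivative. -/
theorem PME.IsNonnegLocalWeakSolution.hasDerivAt_correlation {n : ℕ} {E : Set (Rn n)}
    {T m ν L : ℝ} {A : Rn n × ℝ → ℝ → Rn n → Rn n} {f u : Rn n × ℝ → ℝ} {G : Rn n × ℝ → Rn n}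
    (hm : 0 < m) (hA : StructureConditions E T ν L A) (hf : MemLpLoc f ⊤ (spaceTime E T))
    (hu : IsNonnegLocalWeakSolution E T m A f u G)
    {χ : ℝ → ℝ} {ψ : Rn n → ℝ} (hχ : Continuous χ) (hχc : HasCompactSupport χ)
    (hχT : tsupport χ ⊆ Ioo 0 T) (hψ : IsTestFunction E ψ) (k : ℝ)
    {K : Set (Rn n × ℝ)} (hK : IsCompact K) (hKE : K ⊆ spaceTime E T)
    (huK : MemLp u (ENNReal.ofReal (m + 1)) (volume.restrict K)) {r : ℝ} (hr : 0 < r)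
    (hKr : ∀ z ∈ tsupport ψ ×ˢ tsupport χ, ∀ y, ‖y‖ < r → z + y ∈ K) :
    HasDerivAt (fun τ : ℝ => ∫ z, K.indicator u z *
        cutoffFun χ ψ k (fun z => u z ^ m) (z - τ • ((0, 1) : Rn n × ℝ)))
      (-((∫ z, inner ℝ (K.indicator (fun z => A z (u z) (G z)) z)
            (cutoffGrad χ ψ k (fun z => u z ^ m) G z))
          - ∫ z, K.indicator f z * cutoffFun χ ψ k (fun z => u z ^ m) z)) 0 := by
  have hψ1 : ContDiff ℝ 1 ψ := hψ.contDiff.of_le (by simp)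
  have hS : IsCompact (tsupport ψ ×ˢ tsupport χ) :=
    IsCompact.prod (show IsCompact (tsupport ψ) from hψ.hasCompactSupport) hχc
  have hSK : tsupport ψ ×ˢ tsupport χ ⊆ K := fun z hz => by
    simpa using hKr z hz 0 (by simpa using hr)
  have hSE : tsupport ψ ×ˢ tsupport χ ⊆ spaceTime E T := hSK.trans hKE
  have hKm := hK.measurableSet
  have : IsFiniteMeasure ((volume : Measure (Rn n × ℝ)).restrict K) :=
    ⟨by simpa using hK.measure_lt_top⟩
  set w : Rn n × ℝ → ℝ := fun z => u z ^ m with hw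
  set W := cutoffFun χ ψ k w with hWdef
  set H := cutoffGrad χ ψ k w G with hHdef
  set u₁ := K.indicator u with hu₁
  set A₁ := K.indicator (fun z => A z (u z) (G z)) with hA₁
  set f₁ := K.indicator f with hf₁
  have hW : MemLp W 2 := memLp_cutoffFun hχ hχc hψ.contDiff.continuous hψ.hasCompactSupport
    (hu.sobolev.memLpLoc _ hS hSE)
  have hH : MemLp H 2 := memLp_cutoffGrad hχ hχc hψ1 hψ.hasCompactSupport
    (hu.sobolev.memLpLoc _ hS hSE) (hu.sobolev.memLpLoc_grad _ hS hSE)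
  have hu0 : ∀ᵐ z ∂(volume.restrict K), 0 ≤ u z :=
    ae_mono (Measure.restrict_mono hKE le_rfl) hu.nonneg
  -- Two integrabilities of `W` are needed: this one pairs with `u ∈ L^(m+1)`, while `L²` pairs with
  -- the source.
  have hW' : MemLp W (ENNReal.ofReal ((m + 1) / m)) :=
    memLp_cutoffFun hχ hχc hψ.contDiff.continuous hψ.hasCompactSupport
      ((memLp_rpow hm huK hu0).mono_measure (Measure.restrict_mono hSK le_rfl))
  have hu₁' : MemLp u₁ (ENNReal.ofReal (m + 1)) := (memLp_indicator_iff_restrict hKm).2 huK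
  have hA₁' : MemLp A₁ 2 := (memLp_indicator_iff_restrict hKm).2
    (hA.memLp_comp hKE huK.1.aemeasurable (hu.sobolev.memLpLoc_grad _ hK hKE))
  have hf₁' : MemLp f₁ 2 := (memLp_indicator_iff_restrict hKm).2
    ((hf _ hK hKE).mono_exponent le_top)
  have := holderConjugate_ofReal hm
  have hJc := continuous_integral_correlation (ContinuousLinearMap.mul ℝ ℝ) _ _
    ENNReal.ofReal_ne_top hu₁' hW'
  have hac := continuous_integral_correlation (innerCLM (Rn n)) 2 2 (by simp) hA₁' hH
  have hfc := continuous_integral_correlation (ContinuousLinearMap.mul ℝ ℝ) 2 2 (by simp) hf₁' hW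
  simp only [ContinuousLinearMap.mul_apply', innerCLM_apply] at hJc hac hfc
  -- It remains to verify the distributional identity for kernels supported in the ball of radius
  -- `r`, whose mollifications are supported in `K`.
  have hmain := hasDerivAt_of_integral_fderiv_eq hJc (hac.sub hfc) ((0, 1) : Rn n × ℝ) hr
    (μ := volume) ?_
  · simpa using hmain
  intro η hη hηc hηr
  have hηd : HasCompactSupport (fun y => fderiv ℝ η y ((0, 1) : Rn n × ℝ)) :=
    (hηc.fderiv ℝ).comp_left (g := fun D : Rn n × ℝ →L[ℝ] ℝ => D (0, 1)) (by simp)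
  have hηd' : Continuous (fun y => fderiv ℝ η y ((0, 1) : Rn n × ℝ)) :=
    (hη.continuous_fderiv (by simp)).clm_apply continuous_const
  set φ : Rn n × ℝ → ℝ := fun z => ∫ y, η y • W (z - y) with hφdef
  obtain ⟨hφ, hφK, hφt, hφx⟩ := hu.sobolev.mollification hχ hχc hχT hψ k hK hKE hKr hη hηc hηr
    hφdef
  have hφd : Differentiable ℝ φ := hφ.contDiff.differentiable (by simp)
  have hweak := hu.integral_eq φ hφ
  have h0 : ∀ z ∉ K, φ z = 0 ∧ deriv (fun t => φ (z.1, t)) z.2 = 0 ∧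
      gradient (fun x => φ (x, z.2)) z.1 = 0 := by
    intro z hz
    have hz' : z ∉ tsupport φ := fun h => hz (hφK h)
    refine ⟨image_eq_zero_of_notMem_tsupport hz', ?_, ?_⟩
    · rw [deriv_slice (hφd z), fderiv_of_notMem_tsupport ℝ hz']; rfl
    · rw [gradient_slice_eq hφd, fderiv_of_notMem_tsupport ℝ hz']; simp
  have hK' : ∀ z ∉ spaceTime E T, z ∉ K := fun z hz h => hz (hKE h)
  rw [setIntegral_eq_integral_of_forall_compl_eq_zero (fun z hz => by
      obtain ⟨-, h2, h3⟩ := h0 z (hK' z hz); simp [h2, h3]),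
    setIntegral_eq_integral_of_forall_compl_eq_zero (fun z hz => by
      simp [(h0 z (hK' z hz)).1])] at hweak
  have hweak' : ∫ z, (-(u₁ z * deriv (fun t => φ (z.1, t)) z.2)
      + inner ℝ (A₁ z) (gradient (fun x => φ (x, z.2)) z.1)) = ∫ z, f₁ z * φ z := by
    have e1 : ∀ z, -(u₁ z * deriv (fun t => φ (z.1, t)) z.2)
      + inner ℝ (A₁ z) (gradient (fun x => φ (x, z.2)) z.1) =
        - u z * deriv (fun t => φ (z.1, t)) z.2
          + inner ℝ (A z (u z) (G z)) (gradient (fun x => φ (x, z.2)) z.1) := by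
      intro z
      by_cases hz : z ∈ K
      · simp [hu₁, hA₁, hz]
      · obtain ⟨-, h2, h3⟩ := h0 z hz
        simp [h2, h3]
    have e2 : ∀ z, f₁ z * φ z = f z * φ z := by
      intro z
      by_cases hz : z ∈ K
      · simp [hf₁, hz]
      · simp [(h0 z hz).1]
    simp only [e1, e2]
    exact hweak
  have hφ1 : ContDiff ℝ 1 φ := hφ.contDiff.of_le (by simp)
  have hgc : HasCompactSupport fun z : Rn n × ℝ => gradient (fun x => φ (x, z.2)) z.1 := by
    refine HasCompactSupport.intro hK fun z hz => (h0 z hz).2.2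
  have hgc' := (continuous_gradient_slice hφ1)
  have htc : HasCompactSupport fun z : Rn n × ℝ => deriv (fun t => φ (z.1, t)) z.2 := by
    refine HasCompactSupport.intro hK fun z hz => (h0 z hz).2.1
  have htc' : Continuous fun z : Rn n × ℝ => deriv (fun t => φ (z.1, t)) z.2 := by
    simp_rw [deriv_slice (hφd _)]
    exact (hφ1.continuous_fderiv one_ne_zero).clm_apply continuous_const
  have hi1 := integrable_bilin (ContinuousLinearMap.mul ℝ ℝ) _ _ hu₁'
    (htc'.memLp_of_hasCompactSupport (p := ENNReal.ofReal ((m + 1) / m)) (μ := volume) htc)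
  have hi2 := integrable_bilin (innerCLM (Rn n)) 2 2 hA₁'
    (hgc'.memLp_of_hasCompactSupport (p := 2) (μ := volume) hgc)
  simp only [ContinuousLinearMap.mul_apply', innerCLM_apply] at hi1 hi2
  have hi1' : Integrable (fun z => -(u₁ z * deriv (fun t => φ (z.1, t)) z.2)) := hi1.neg
  rw [integral_add hi1' hi2, integral_neg] at hweak'
  simp only [hφt, hφx] at hweak'
  have f1 := integral_bilin_convolution_eq (ContinuousLinearMap.mul ℝ ℝ) _ _
    ENNReal.ofReal_ne_top hu₁' hW' hηd' hηd
  have f2 := integral_bilin_convolution_eq (innerCLM (Rn n)) 2 2 (by simp) hA₁' hH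
    hη.continuous hηc
  have f3 := integral_bilin_convolution_eq (ContinuousLinearMap.mul ℝ ℝ) 2 2 (by simp) hf₁' hW
    hη.continuous hηc
  simp only [ContinuousLinearMap.mul_apply', innerCLM_apply] at f1 f2 f3
  rw [f1, f2] at hweak'
  simp only [hφdef] at hweak'
  rw [f3] at hweak'
  simp only [Pi.sub_apply, sub_mul]
  have hi3 : Integrable fun y => (∫ z, inner ℝ (A₁ z) (H (z - y))) * η y :=
    (hac.mul hη.continuous).integrable_of_hasCompactSupport hηc.mul_left
  have hi4 : Integrable fun y => (∫ z, f₁ z * W (z - y)) * η y :=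
    (hfc.mul hη.continuous).integrable_of_hasCompactSupport hηc.mul_left
  rw [integral_sub hi3 hi4]
  linarith

/-! ### Energy inequalities for general cutoffs -/

theorem integrable_bregman {X : Type*} [MeasurableSpace X] {μ : Measure X} [IsFiniteMeasure μ]
    {m : ℝ} (hm : 0 < m) {u : X → ℝ} (hu : MemLp u (ENNReal.ofReal (m + 1)) μ)
    (h0 : ∀ᵐ z ∂μ, 0 ≤ u z) (c : ℝ) : Integrable (fun z => bregman m (u z) c) μ := by
  have h1 : Integrable (fun z => u z ^ (m + 1)) μ := by
    have := hu.integrable_norm_rpow (by simp; linarith) (by simp)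
    rw [ENNReal.toReal_ofReal (by linarith)] at this
    refine this.congr ?_
    filter_upwards [h0] with z hz
    rw [Real.norm_of_nonneg hz]
  have h2 : Integrable u μ := hu.integrable (by simp [hm.le])
  exact ((h1.sub (integrable_const _)).div_const _).sub
    ((h2.sub (integrable_const _)).const_mul _)

/-- The energy inequality with a general cutoff function. -/
theorem PME.IsNonnegLocalWeakSolution.integral_cutoff_le {n : ℕ} {E : Set (Rn n)}
    {T m ν L : ℝ} {A : Rn n × ℝ → ℝ → Rn n → Rn n} {f u : Rn n × ℝ → ℝ} {G : Rn n × ℝ → Rn n}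
    (hm : 0 < m) (hm1 : m < 1) (hA : StructureConditions E T ν L A)
    (hf : MemLpLoc f ⊤ (spaceTime E T))
    (hu : IsNonnegLocalWeakSolution E T m A f u G)
    {χ χ' : ℝ → ℝ} {ψ : Rn n → ℝ} {C : NNReal} (hχ : LipschitzWith C χ)
    (hχ' : ∀ᵐ t, HasDerivAt χ (χ' t) t) (hχ0 : ∀ t, 0 ≤ χ t) (hχc : HasCompactSupport χ)
    (hχT : tsupport χ ⊆ Ioo 0 T) (hψ : IsTestFunction E ψ) (hψ0 : ∀ x, 0 ≤ ψ x) (c : ℝ)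
    {K : Set (Rn n × ℝ)} (hK : IsCompact K) (hKE : K ⊆ spaceTime E T)
    (huK : MemLp u (ENNReal.ofReal (m + 1)) (volume.restrict K)) {r : ℝ} (hr : 0 < r)
    (hKr : ∀ z ∈ tsupport ψ ×ˢ tsupport χ, ∀ y, ‖y‖ < r → z + y ∈ K) :
    ((∫ z, inner ℝ (K.indicator (fun z => A z (u z) (G z)) z)
            (cutoffGrad χ ψ (c ^ m) (fun z => u z ^ m) G z))
          - ∫ z, K.indicator f z * cutoffFun χ ψ (c ^ m) (fun z => u z ^ m) z)
      ≤ ∫ z, K.indicator (fun z => bregman m (u z) c) z * (ψ z.1 * χ' z.2) := by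
  have hder := hu.hasDerivAt_correlation hm hA hf hχ.continuous hχc hχT hψ (c ^ m) hK hKE huK hr hKr
  set b := ((∫ z, inner ℝ (K.indicator (fun z => A z (u z) (G z)) z)
            (cutoffGrad χ ψ (c ^ m) (fun z => u z ^ m) G z))
          - ∫ z, K.indicator f z * cutoffFun χ ψ (c ^ m) (fun z => u z ^ m) z) with hb
  set W := cutoffFun χ ψ (c ^ m) (fun z => u z ^ m) with hW
  set e : Rn n × ℝ := (0, 1) with he
  set u₁ := K.indicator u with hu₁
  set F₁ := K.indicator (fun z => bregman m (u z) c) with hF₁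
  have hKm := hK.measurableSet
  have : IsFiniteMeasure ((volume : Measure (Rn n × ℝ)).restrict K) :=
    ⟨by simpa using hK.measure_lt_top⟩
  have hu0 : ∀ᵐ z ∂(volume.restrict K), 0 ≤ u z :=
    ae_mono (Measure.restrict_mono hKE le_rfl) hu.nonneg
  have hS : IsCompact (tsupport ψ ×ˢ tsupport χ) :=
    IsCompact.prod (show IsCompact (tsupport ψ) from hψ.hasCompactSupport) hχc
  have hSK : tsupport ψ ×ˢ tsupport χ ⊆ K := fun z hz => by
    simpa using hKr z hz 0 (by simpa using hr)
  have hWp : MemLp W (ENNReal.ofReal ((m + 1) / m)) :=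
    memLp_cutoffFun hχ.continuous hχc hψ.contDiff.continuous hψ.hasCompactSupport
      ((memLp_rpow hm huK hu0).mono_measure (Measure.restrict_mono hSK le_rfl))
  have hup : MemLp u₁ (ENNReal.ofReal (m + 1)) := (memLp_indicator_iff_restrict hKm).2 huK
  have hF : Integrable F₁ :=
    (integrable_indicator_iff hKm).2 (integrable_bregman hm huK hu0 c)
  have hconj := holderConjugate_ofReal hm
  have hshift : ∀ h : ℝ, MeasurePreserving (fun z : Rn n × ℝ => z - h • e) volume volume :=
    fun h => measurePreserving_sub_right volume (h • e)
  have hψχ : ∀ h : ℝ, Integrable (fun z : Rn n × ℝ => F₁ z * (ψ z.1 * χ (z.2 + h))) := by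
    intro h
    obtain ⟨M, hM⟩ := hψ.contDiff.continuous.bounded_above_of_compact_support hψ.hasCompactSupport
    obtain ⟨N, hN⟩ := hχ.continuous.bounded_above_of_compact_support hχc
    have hcont : Continuous fun z : Rn n × ℝ => ψ z.1 * χ (z.2 + h) :=
      (hψ.contDiff.continuous.comp continuous_fst).mul
        (hχ.continuous.comp (continuous_snd.add continuous_const))
    refine hF.mul_bdd (c := M * N) hcont.aestronglyMeasurable (Eventually.of_forall fun z => ?_)
    rw [norm_mul]
    exact mul_le_mul (hM _) (hN _) (norm_nonneg _) ((norm_nonneg _).trans (hM z.1))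
  -- Discrete energy inequality. The backward quotient is the one for which convexity, with the
  -- later value of `u` inside `W`, points the right way; `h < r` keeps the shifted points in `K`.
  have hstep : ∀ h : ℝ, 0 < h → h < r →
      ∫ z, F₁ z * (ψ z.1 * ((χ z.2 - χ (z.2 + h)) / h)) ≤
        h⁻¹ * ((∫ z, u₁ z * W (z - (0 : ℝ) • e)) - ∫ z, u₁ z * W (z - (-h) • e)) := by
    intro h hh hhr
    have hi1 : Integrable fun z => u₁ z * W z := by
      simpa using integrable_bilin (ContinuousLinearMap.mul ℝ ℝ) _ _ hup hWp
    have hi2 : Integrable fun z => u₁ (z - h • e) * W z := by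
      simpa using integrable_bilin (ContinuousLinearMap.mul ℝ ℝ) _ _
        (hup.comp_measurePreserving (hshift h)) hWp
    have e1 : ∫ z, u₁ z * W (z - (-h) • e) = ∫ z, u₁ (z - h • e) * W z := by
      rw [← integral_sub_right_eq_self _ (h • e)]
      simp
    have hi3 : Integrable fun z => F₁ z * (ψ z.1 * χ z.2) := by simpa using hψχ 0
    have hi4 : Integrable fun z => F₁ (z - h • e) * (ψ z.1 * χ z.2) := by
      have := (hψχ h).comp_sub_right (h • e)
      simpa [he] using this
    have e2 : ∫ z, F₁ z * (ψ z.1 * χ (z.2 + h)) = ∫ z, F₁ (z - h • e) * (ψ z.1 * χ z.2) := by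
      rw [← integral_sub_right_eq_self _ (h • e)]
      simp [he]
    have e3 : ∫ z, F₁ z * (ψ z.1 * ((χ z.2 - χ (z.2 + h)) / h))
        = h⁻¹ * ((∫ z, F₁ z * (ψ z.1 * χ z.2)) - ∫ z, F₁ z * (ψ z.1 * χ (z.2 + h))) := by
      rw [← integral_sub hi3 (hψχ h), ← integral_const_mul]
      refine integral_congr_ae (Eventually.of_forall fun z => ?_)
      simp only; ring
    simp only [zero_smul, sub_zero]
    rw [e3, e1, e2, ← integral_sub hi3 hi4, ← integral_sub hi1 hi2]
    refine mul_le_mul_of_nonneg_left ?_ (by positivity)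
    refine integral_mono_ae (hi3.sub hi4) (hi1.sub hi2) ?_
    have hu0' : ∀ᵐ z, z ∈ K → 0 ≤ u z := (ae_restrict_iff' hKm).1 hu0
    filter_upwards [hu0', (hshift h).quasiMeasurePreserving.ae hu0'] with z hz hz'
    by_cases hzS : z ∈ tsupport ψ ×ˢ tsupport χ
    · have hzK : z ∈ K := hSK hzS
      have hzK' : z - h • e ∈ K := by
        have := hKr z hzS (-(h • e)) (by
          rw [norm_neg, norm_smul, he]
          simpa [abs_of_pos hh] using hhr)
        rwa [← sub_eq_add_neg] at this
      simp only [hF₁, hu₁, indicator_of_mem hzK, indicator_of_mem hzK', hW, cutoffFun]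
      have := bregman_sub_bregman_le (c := c) hm hm1 (hz hzK) (hz' hzK')
      have h2 := mul_le_mul_of_nonneg_left this (mul_nonneg (hψ0 z.1) (hχ0 z.2))
      nlinarith [h2]
    · have h1 : W z = 0 := cutoffFun_eq_zero hzS
      have h2 : ψ z.1 * χ z.2 = 0 := by
        rw [mem_prod, not_and_or] at hzS
        rcases hzS with hz | hz
        · simp [image_eq_zero_of_notMem_tsupport hz]
        · simp [image_eq_zero_of_notMem_tsupport hz]
      simp [h1, h2]
  have hlim1 : Tendsto (fun h : ℝ =>
      h⁻¹ * ((∫ z, u₁ z * W (z - (0 : ℝ) • e)) - ∫ z, u₁ z * W (z - (-h) • e))) (𝓝[>] 0)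
      (𝓝 (-b)) := by
    have h1 := (HasDerivAt.tendsto_slope hder)
    have h2 : Tendsto (fun h : ℝ => -h) (𝓝[>] 0) (𝓝[≠] 0) := by
      refine tendsto_nhdsWithin_iff.2 ⟨?_, ?_⟩
      · have : Tendsto (fun h : ℝ => -h) (𝓝 0) (𝓝 (-0)) := continuous_neg.tendsto 0
        rw [neg_zero] at this
        exact this.mono_left nhdsWithin_le_nhds
      · filter_upwards [self_mem_nhdsWithin] with h hh
        simpa using (ne_of_gt hh : h ≠ 0)
    refine (h1.comp h2).congr fun h => ?_
    simp only [Function.comp_def, slope_def_field]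
    rw [sub_zero, div_eq_inv_mul, inv_neg]
    ring
  -- The Lipschitz constant of `χ` dominates the quotients, so differentiability of `χ` at almost
  -- every time suffices.
  have hlim2 : Tendsto (fun h : ℝ => ∫ z, F₁ z * (ψ z.1 * ((χ z.2 - χ (z.2 + h)) / h))) (𝓝[>] 0)
      (𝓝 (∫ z, F₁ z * (ψ z.1 * (-χ' z.2)))) := by
    obtain ⟨M, hM⟩ := hψ.contDiff.continuous.bounded_above_of_compact_support hψ.hasCompactSupport
    refine tendsto_integral_filter_of_dominated_convergence (fun z => ‖F₁ z‖ * (M * C)) ?_ ?_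
      (hF.norm.mul_const _) ?_
    · refine Eventually.of_forall fun h => ?_
      refine hF.1.mul (Continuous.aestronglyMeasurable ?_)
      have := hψ.contDiff.continuous
      have := hχ.continuous
      fun_prop
    · filter_upwards [self_mem_nhdsWithin] with h hh
      refine Eventually.of_forall fun z => ?_
      have hh0 : (0 : ℝ) < h := hh
      have h1 : |χ z.2 - χ (z.2 + h)| ≤ C * h := by
        have := hχ.dist_le_mul z.2 (z.2 + h)
        rw [Real.dist_eq, Real.dist_eq] at this
        simpa [abs_of_pos hh0] using this
      have h2 : ‖(χ z.2 - χ (z.2 + h)) / h‖ ≤ C := by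
        rw [norm_div, Real.norm_eq_abs, Real.norm_of_nonneg hh0.le, div_le_iff₀ hh0]
        exact h1
      rw [norm_mul, norm_mul]
      have := (norm_nonneg _).trans (hM z.1)
      gcongr
      exact hM _
    · filter_upwards [Measure.quasiMeasurePreserving_snd.ae hχ'] with z hz
      refine Tendsto.const_mul _ (Tendsto.const_mul _ ?_)
      have h1 := hz.tendsto_slope_zero_right
      refine h1.neg.congr fun h => ?_
      simp only [smul_eq_mul]
      ring
  have hfin := le_of_tendsto_of_tendsto hlim2 hlim1 (by
    filter_upwards [self_mem_nhdsWithin, mem_nhdsWithin_of_mem_nhds (Iio_mem_nhds hr)] with h h1 h2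
    exact hstep h h1 h2)
  simp only [mul_neg, integral_neg] at hfin
  linarith

/-- Pointwise absorption by two completed squares. Here `g = |Du^m|`, `v = u^m - c^m`, and `I₁`,
`I₂` are the flux paired with `Du^m` and with `D(ζ²)`. Half of the coercive term pays for the cross
term; the weight `ρ` balances the source against `v²/ρ²`. -/
theorem energy_young {ν L D ρ χ ζ g v f I₁ I₂ : ℝ} (hν : 0 < ν) (hρ : 0 < ρ)
    (hχ0 : 0 ≤ χ) (hχ1 : χ ≤ 1) (hζ0 : 0 ≤ ζ) (hζ1 : ζ ≤ 1)
    (h₁ : ν * g ^ 2 ≤ I₁) (h₂ : |I₂| ≤ 2 * (ζ * D) * (L * g)) :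
    ν / 2 * (χ * ζ ^ 2 * g ^ 2) - ((2 * L ^ 2 * D ^ 2 / ν + 1 / (2 * ρ ^ 2)) * v ^ 2
        + ρ ^ 2 * f ^ 2 / 2)
      ≤ χ * (ζ ^ 2 * I₁ + v * I₂) - f * (χ * (ζ ^ 2 * v)) := by
  have hvI : -(|v| * (2 * (ζ * D) * (L * g))) ≤ v * I₂ := by
    have : |v * I₂| ≤ |v| * (2 * (ζ * D) * (L * g)) := by rw [abs_mul]; gcongr
    exact (abs_le.1 this).1
  have hsq : 0 ≤ ν / 2 * (ζ * g - 2 * L * D * |v| / ν) ^ 2 := by positivity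
  have hexp : ν / 2 * (ζ * g - 2 * L * D * |v| / ν) ^ 2
      = ν / 2 * (ζ ^ 2 * g ^ 2) - |v| * (2 * (ζ * D) * (L * g))
        + 2 * L ^ 2 * D ^ 2 / ν * v ^ 2 := by
    rw [← sq_abs v]; field_simp; ring
  have hI₁ : ζ ^ 2 * (ν * g ^ 2) ≤ ζ ^ 2 * I₁ := by gcongr
  have hA : ν / 2 * (ζ ^ 2 * g ^ 2) - 2 * L ^ 2 * D ^ 2 / ν * v ^ 2 ≤ ζ ^ 2 * I₁ + v * I₂ := by
    linarith
  have hA' := mul_le_mul_of_nonneg_left hA hχ0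
  have hq : 0 ≤ 2 * L ^ 2 * D ^ 2 / ν * v ^ 2 := by positivity
  have hq' : χ * (2 * L ^ 2 * D ^ 2 / ν * v ^ 2) ≤ 2 * L ^ 2 * D ^ 2 / ν * v ^ 2 :=
    mul_le_of_le_one_left hq hχ1
  have hfv : f * v ≤ 1 / (2 * ρ ^ 2) * v ^ 2 + ρ ^ 2 * f ^ 2 / 2 := by
    have : 0 ≤ (ρ * f - v / ρ) ^ 2 / 2 := by positivity
    have h2 : (ρ * f - v / ρ) ^ 2 / 2 = ρ ^ 2 * f ^ 2 / 2 + 1 / (2 * ρ ^ 2) * v ^ 2 - f * v := by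
      field_simp; ring
    linarith
  have hB0 : 0 ≤ 1 / (2 * ρ ^ 2) * v ^ 2 + ρ ^ 2 * f ^ 2 / 2 := by positivity
  have hs1 : χ * ζ ^ 2 ≤ 1 := mul_le_one₀ hχ1 (by positivity) (pow_le_one₀ hζ0 hζ1)
  have hB : (χ * ζ ^ 2) * (f * v) ≤ 1 / (2 * ρ ^ 2) * v ^ 2 + ρ ^ 2 * f ^ 2 / 2 :=
    (mul_le_mul_of_nonneg_left hfv (by positivity)).trans (mul_le_of_le_one_left hB0 hs1)
  nlinarith [hA', hq', hB]

/-- The energy inequality, with the diffusion and source terms absorbed. -/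
theorem PME.IsNonnegLocalWeakSolution.energy_le {n : ℕ} {E : Set (Rn n)}
    {T m ν L : ℝ} {A : Rn n × ℝ → ℝ → Rn n → Rn n} {f u : Rn n × ℝ → ℝ} {G : Rn n × ℝ → Rn n}
    (hm : 0 < m) (hm1 : m < 1) (hν : 0 < ν) (hνL : ν ≤ L) (hA : StructureConditions E T ν L A)
    (hf : MemLpLoc f ⊤ (spaceTime E T))
    (hu : IsNonnegLocalWeakSolution E T m A f u G)
    {χ χ' : ℝ → ℝ} {ζ : Rn n → ℝ} {C : NNReal} (hχ : LipschitzWith C χ)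
    (hχ' : ∀ᵐ t, HasDerivAt χ (χ' t) t) (hχ0 : ∀ t, 0 ≤ χ t) (hχ1 : ∀ t, χ t ≤ 1)
    (hχc : HasCompactSupport χ)
    (hχT : tsupport χ ⊆ Ioo 0 T) (hζ : IsTestFunction E ζ) (hζ0 : ∀ x, 0 ≤ ζ x)
    (hζ1 : ∀ x, ζ x ≤ 1) {D : ℝ} (hD : ∀ x, ‖gradient ζ x‖ ≤ D) (c : ℝ)
    {K : Set (Rn n × ℝ)} (hK : IsCompact K) (hKE : K ⊆ spaceTime E T)
    (huK : MemLp u (ENNReal.ofReal (m + 1)) (volume.restrict K)) {r : ℝ} (hr : 0 < r)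
    (hKr : ∀ z ∈ tsupport ζ ×ˢ tsupport χ, ∀ y, ‖y‖ < r → z + y ∈ K) {ρ : ℝ} (hρ : 0 < ρ) :
    ν / 2 * (∫ z in K, χ z.2 * ζ z.1 ^ 2 * ‖G z‖ ^ 2)
        - ∫ z in K, bregman m (u z) c * (ζ z.1 ^ 2 * χ' z.2)
      ≤ (2 * L ^ 2 * D ^ 2 / ν + 1 / (2 * ρ ^ 2)) * (∫ z in K, (u z ^ m - c ^ m) ^ 2)
        + (∫ z in K, ρ ^ 2 * f z ^ 2) / 2 := by
  have hζ1' : ContDiff ℝ 1 ζ := hζ.contDiff.of_le (by simp)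
  -- With a square, `Dψ = 2 ζ Dζ` retains one factor `ζ`, needed to absorb the cross term into `ζ²
  -- |Du^m|²`.
  set ψ : Rn n → ℝ := fun x => ζ x * ζ x with hψdef
  have hψsupp : tsupport ψ ⊆ tsupport ζ := tsupport_mul_subset_left (f := ζ) (g := ζ)
  have hψ : IsTestFunction E ψ :=
    ⟨hζ.contDiff.mul hζ.contDiff, hζ.hasCompactSupport.mul_right, hψsupp.trans hζ.tsupport_subset⟩
  have hψ1 : ContDiff ℝ 1 ψ := hψ.contDiff.of_le (by simp)
  have hψr : ∀ z ∈ tsupport ψ ×ˢ tsupport χ, ∀ y, ‖y‖ < r → z + y ∈ K := fun z hz =>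
    hKr z ⟨hψsupp hz.1, hz.2⟩
  have hmain := hu.integral_cutoff_le hm hm1 hA hf hχ hχ' hχ0 hχc hχT hψ
    (fun x => mul_self_nonneg _) c hK hKE huK hr hψr
  have hKm := hK.measurableSet
  have : IsFiniteMeasure ((volume : Measure (Rn n × ℝ)).restrict K) :=
    ⟨by simpa using hK.measure_lt_top⟩
  have hS : IsCompact (tsupport ψ ×ˢ tsupport χ) :=
    IsCompact.prod (show IsCompact (tsupport ψ) from hψ.hasCompactSupport) hχc
  have hSK : tsupport ψ ×ˢ tsupport χ ⊆ K := fun z hz => by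
    simpa using hψr z hz 0 (by simpa using hr)
  have hSE := hSK.trans hKE
  have hW := memLp_cutoffFun (k := c ^ m) hχ.continuous hχc hψ.contDiff.continuous
    hψ.hasCompactSupport (hu.sobolev.memLpLoc _ hS hSE)
  have hH := memLp_cutoffGrad (k := c ^ m) hχ.continuous hχc hψ1 hψ.hasCompactSupport
    (hu.sobolev.memLpLoc _ hS hSE) (hu.sobolev.memLpLoc_grad _ hS hSE)
  have hGK := hu.sobolev.memLpLoc_grad _ hK hKE
  have hwK := hu.sobolev.memLpLoc _ hK hKE
  have hfK : MemLp f 2 (volume.restrict K) := (hf _ hK hKE).mono_exponent le_top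
  have hA₁ := (memLp_indicator_iff_restrict hKm).2 (hA.memLp_comp hKE huK.1.aemeasurable hGK)
  have hf₁ := (memLp_indicator_iff_restrict hKm).2 hfK
  have hi1 : Integrable fun z => inner ℝ (K.indicator (fun z => A z (u z) (G z)) z)
      (cutoffGrad χ ψ (c ^ m) (fun z => u z ^ m) G z) := by
    simpa using integrable_bilin (innerCLM (Rn n)) 2 2 hA₁ hH
  have hi2 : Integrable fun z => K.indicator f z * cutoffFun χ ψ (c ^ m) (fun z => u z ^ m) z := by
    simpa using integrable_bilin (ContinuousLinearMap.mul ℝ ℝ) 2 2 hf₁ hW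
  have hi3 : Integrable (fun z => χ z.2 * ζ z.1 ^ 2 * ‖G z‖ ^ 2) (volume.restrict K) := by
    have hcont : Continuous fun z : Rn n × ℝ => χ z.2 * ζ z.1 ^ 2 :=
      (hχ.continuous.comp continuous_snd).mul ((hζ.contDiff.continuous.comp continuous_fst).pow 2)
    refine Integrable.bdd_mul (c := 1) hGK.norm.integrable_sq hcont.aestronglyMeasurable
      (Eventually.of_forall fun z => ?_)
    rw [Real.norm_of_nonneg (mul_nonneg (hχ0 _) (sq_nonneg _))]
    exact mul_le_one₀ (hχ1 _) (by positivity) (pow_le_one₀ (hζ0 _) (hζ1 _))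
  have hi4 : Integrable (fun z => (u z ^ m - c ^ m) ^ 2) (volume.restrict K) :=
    (hwK.sub (memLp_const (c ^ m))).integrable_sq
  have hi5 : Integrable (fun z => ρ ^ 2 * f z ^ 2) (volume.restrict K) :=
    hfK.integrable_sq.const_mul _
  have hbreg : ∫ z in K, bregman m (u z) c * (ζ z.1 ^ 2 * χ' z.2)
      = ∫ z, K.indicator (fun z => bregman m (u z) c) z * (ψ z.1 * χ' z.2) := by
    rw [← integral_indicator hKm]
    refine integral_congr_ae (Eventually.of_forall fun z => ?_)
    by_cases hz : z ∈ K <;> simp [hz, hψdef, sq]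
  have hpt : ∀ᵐ z ∂(volume.restrict K),
      ν / 2 * (χ z.2 * ζ z.1 ^ 2 * ‖G z‖ ^ 2)
        - ((2 * L ^ 2 * D ^ 2 / ν + 1 / (2 * ρ ^ 2)) * (u z ^ m - c ^ m) ^ 2
          + ρ ^ 2 * f z ^ 2 / 2)
      ≤ inner ℝ (K.indicator (fun z => A z (u z) (G z)) z)
          (cutoffGrad χ ψ (c ^ m) (fun z => u z ^ m) G z)
        - K.indicator f z * cutoffFun χ ψ (c ^ m) (fun z => u z ^ m) z := by
    filter_upwards [ae_mono (Measure.restrict_mono hKE le_rfl) hA.coercive,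
      ae_mono (Measure.restrict_mono hKE le_rfl) hA.growth, ae_restrict_mem hKm] with z hco hgr hz
    have hgψ : gradient ψ z.1 = (2 * ζ z.1) • gradient ζ z.1 := by
      have hd := hζ1'.differentiable one_ne_zero z.1
      rw [hψdef, gradient_fun_mul hd hd]
      module
    have h2 : |inner ℝ (A z (u z) (G z)) (gradient ψ z.1)|
        ≤ 2 * (ζ z.1 * D) * (L * ‖G z‖) := by
      refine (abs_real_inner_le_norm _ _).trans ?_
      rw [hgψ, norm_smul, Real.norm_of_nonneg (by linarith [hζ0 z.1])]
      have hg' := hgr (u z) (G z)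
      have hζz := hζ0 z.1
      calc ‖A z (u z) (G z)‖ * (2 * ζ z.1 * ‖gradient ζ z.1‖)
          ≤ (L * ‖G z‖) * (2 * ζ z.1 * D) := by
            have hL : 0 ≤ L := hν.le.trans hνL
            gcongr
            exact hD _
        _ = _ := by ring
    have := energy_young (v := u z ^ m - c ^ m) (f := f z) hν hρ (hχ0 z.2) (hχ1 z.2) (hζ0 z.1)
      (hζ1 z.1) (hco (u z) (G z)) h2
    refine this.trans (le_of_eq ?_)
    simp only [indicator_of_mem hz, cutoffGrad, cutoffFun, inner_smul_right, inner_add_right,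
      hψdef, sq]
  have h0 : ∀ z ∉ K, inner ℝ (K.indicator (fun z => A z (u z) (G z)) z)
          (cutoffGrad χ ψ (c ^ m) (fun z => u z ^ m) G z)
        - K.indicator f z * cutoffFun χ ψ (c ^ m) (fun z => u z ^ m) z = 0 := fun z hz => by
    simp [hz]
  have hi6 : Integrable (fun z => (2 * L ^ 2 * D ^ 2 / ν + 1 / (2 * ρ ^ 2)) *
      (u z ^ m - c ^ m) ^ 2 + ρ ^ 2 * f z ^ 2 / 2) (volume.restrict K) :=
    (hi4.const_mul _).add (hi5.div_const 2)
  have hint := integral_mono_ae ((hi3.const_mul (ν / 2)).sub hi6) (hi1.sub hi2).restrict hpt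
  simp only [Pi.sub_apply] at hint
  have hsplit : ∫ z, (ν / 2 * (χ z.2 * ζ z.1 ^ 2 * ‖G z‖ ^ 2)
        - ((2 * L ^ 2 * D ^ 2 / ν + 1 / (2 * ρ ^ 2)) * (u z ^ m - c ^ m) ^ 2
          + ρ ^ 2 * f z ^ 2 / 2)) ∂(volume.restrict K)
      = ν / 2 * (∫ z in K, χ z.2 * ζ z.1 ^ 2 * ‖G z‖ ^ 2)
        - ((2 * L ^ 2 * D ^ 2 / ν + 1 / (2 * ρ ^ 2)) * (∫ z in K, (u z ^ m - c ^ m) ^ 2)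
        + (∫ z in K, ρ ^ 2 * f z ^ 2) / 2) := by
    rw [← integral_const_mul, ← integral_const_mul, ← integral_div, ← integral_add
      (hi4.const_mul _) (hi5.div_const 2), ← integral_sub (hi3.const_mul _) hi6]
  rw [hsplit, setIntegral_eq_integral_of_forall_compl_eq_zero h0, integral_sub hi1 hi2] at hint
  rw [hbreg]
  linarith

/-! ### Cutoff functions and measure-theoretic tools -/

/-- The minimum of two affine ramps and `1`, cut off below at `0`; the derivative is identified off
the four nodes. Its values on the ramps are reciprocals of their lengths, so integration against it
produces averages. -/
theorem exists_trapezoid {a₀ a₁ b₀ b₁ : ℝ} (ha : a₀ < a₁) (hab : a₁ ≤ b₀) (hb : b₀ < b₁) :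
    ∃ (χ : ℝ → ℝ) (C : NNReal), LipschitzWith C χ ∧
      (∀ᵐ t, HasDerivAt χ ((Ioo a₀ a₁).indicator (fun _ => (a₁ - a₀)⁻¹) t
        - (Ioo b₀ b₁).indicator (fun _ => (b₁ - b₀)⁻¹) t) t) ∧
      (∀ t, 0 ≤ χ t) ∧ (∀ t, χ t ≤ 1) ∧ (∀ t ∉ Icc a₀ b₁, χ t = 0) ∧
      ∀ t ∈ Icc a₁ b₀, χ t = 1 := by
  have ha' : 0 < a₁ - a₀ := sub_pos.2 ha
  have hb' : 0 < b₁ - b₀ := sub_pos.2 hb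
  set l : ℝ → ℝ := fun t => (t - a₀) * (a₁ - a₀)⁻¹ with hl
  set g : ℝ → ℝ := fun t => (b₁ - t) * (b₁ - b₀)⁻¹ with hg
  have hld : ∀ t, HasDerivAt l (a₁ - a₀)⁻¹ t := fun t => by
    simpa using ((hasDerivAt_id t).sub_const a₀).mul_const (a₁ - a₀)⁻¹
  have hgd : ∀ t, HasDerivAt g (-(b₁ - b₀)⁻¹) t := fun t => by
    simpa using ((hasDerivAt_id t).const_sub b₁).mul_const (b₁ - b₀)⁻¹
  have hlip : ∀ (h : ℝ → ℝ) (k : ℝ), (∀ t, HasDerivAt h k t) → LipschitzWith ‖k‖₊ h :=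
    fun h k hk => lipschitzWith_of_nnnorm_deriv_le (fun t => (hk t).differentiableAt)
      fun t => by rw [(hk t).deriv]
  have hl1 : ∀ t, 1 ≤ l t ↔ a₁ ≤ t := fun t => by
    rw [hl]; simp only; rw [← div_eq_mul_inv, le_div_iff₀ ha']; constructor <;> intro h <;> linarith
  have hl0 : ∀ t, 0 ≤ l t ↔ a₀ ≤ t := fun t => by
    rw [hl]; simp only; rw [← div_eq_mul_inv, le_div_iff₀ ha']; constructor <;> intro h <;> linarith
  have hg1 : ∀ t, 1 ≤ g t ↔ t ≤ b₀ := fun t => by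
    rw [hg]; simp only; rw [← div_eq_mul_inv, le_div_iff₀ hb']; constructor <;> intro h <;> linarith
  have hg0 : ∀ t, 0 ≤ g t ↔ t ≤ b₁ := fun t => by
    rw [hg]; simp only; rw [← div_eq_mul_inv, le_div_iff₀ hb']; constructor <;> intro h <;> linarith
  set χ : ℝ → ℝ := fun t => max (min (min (l t) (g t)) 1) 0 with hχ
  have hzl : ∀ t, t < a₀ → χ t = 0 := fun t ht => by
    have : l t < 0 := lt_of_not_ge fun h => not_le.2 ht ((hl0 t).1 h)
    exact max_eq_right (((min_le_left _ _).trans (min_le_left _ _)).trans this.le)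
  have hzr : ∀ t, b₁ < t → χ t = 0 := fun t ht => by
    have : g t < 0 := lt_of_not_ge fun h => not_le.2 ht ((hg0 t).1 h)
    exact max_eq_right (((min_le_left _ _).trans (min_le_right _ _)).trans this.le)
  have hone : ∀ t ∈ Icc a₁ b₀, χ t = 1 := fun t ht => by
    have h1 : min (min (l t) (g t)) 1 = 1 :=
      min_eq_right (le_min ((hl1 t).2 ht.1) ((hg1 t).2 ht.2))
    simp only [hχ, h1]; norm_num
  have hleft : ∀ t ∈ Ioo a₀ a₁, χ t = l t := fun t ht => by
    have h1 : l t < 1 := lt_of_not_ge fun h => not_le.2 ht.2 ((hl1 t).1 h)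
    have h2 : 1 ≤ g t := (hg1 t).2 (by linarith [ht.2])
    have h3 : 0 ≤ l t := (hl0 t).2 ht.1.le
    simp only [hχ]
    rw [min_eq_left (h1.le.trans h2), min_eq_left h1.le, max_eq_left h3]
  have hright : ∀ t ∈ Ioo b₀ b₁, χ t = g t := fun t ht => by
    have h1 : g t < 1 := lt_of_not_ge fun h => not_le.2 ht.1 ((hg1 t).1 h)
    have h2 : 1 ≤ l t := (hl1 t).2 (by linarith [ht.1])
    have h3 : 0 ≤ g t := (hg0 t).2 ht.2.le
    simp only [hχ]
    rw [min_eq_right (h1.le.trans h2), min_eq_left h1.le, max_eq_left h3]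
  refine ⟨χ, _, (((hlip l _ hld).min (hlip g _ hgd)).min_const 1).max_const 0, ?_,
    fun t => le_max_right _ _, fun t => max_le (min_le_right _ _) zero_le_one, ?_, hone⟩
  · have hfin : ({a₀, a₁, b₀, b₁} : Set ℝ).Finite := by simp
    filter_upwards [compl_mem_ae_iff.2 (hfin.measure_zero volume)] with t ht
    simp only [mem_compl_iff, mem_insert_iff, mem_singleton_iff, not_or] at ht
    obtain ⟨h1, h2, h3, h4⟩ := ht
    rcases lt_or_gt_of_ne h1 with h1 | h1
    · rw [indicator_of_notMem (fun h => absurd h.1 (by linarith)),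
        indicator_of_notMem (fun h => absurd h.1 (by linarith)), sub_zero]
      refine (hasDerivAt_const t (0 : ℝ)).congr_of_eventuallyEq ?_
      filter_upwards [Iio_mem_nhds h1] with x hx using hzl x hx
    rcases lt_or_gt_of_ne h2 with h2 | h2
    · rw [indicator_of_mem (show t ∈ Ioo a₀ a₁ from ⟨h1, h2⟩),
        indicator_of_notMem (fun h => absurd h.1 (by linarith)), sub_zero]
      refine (hld t).congr_of_eventuallyEq ?_
      filter_upwards [Ioo_mem_nhds h1 h2] with x hx using hleft x hx
    rcases lt_or_gt_of_ne h3 with h3 | h3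
    · rw [indicator_of_notMem (fun h => absurd h.2 (by linarith)),
        indicator_of_notMem (fun h => absurd h.1 (by linarith)), sub_zero]
      refine (hasDerivAt_const t (1 : ℝ)).congr_of_eventuallyEq ?_
      filter_upwards [Ioo_mem_nhds h2 h3] with x hx using hone x (Ioo_subset_Icc_self hx)
    rcases lt_or_gt_of_ne h4 with h4 | h4
    · rw [indicator_of_notMem (fun h => absurd h.2 (by linarith)),
        indicator_of_mem (show t ∈ Ioo b₀ b₁ from ⟨h3, h4⟩), zero_sub]
      refine (hgd t).congr_of_eventuallyEq ?_
      filter_upwards [Ioo_mem_nhds h3 h4] with x hx using hright x hx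
    · rw [indicator_of_notMem (fun h => absurd h.2 (by linarith)),
        indicator_of_notMem (fun h => absurd h.2 (by linarith)), sub_zero]
      refine (hasDerivAt_const t (0 : ℝ)).congr_of_eventuallyEq ?_
      filter_upwards [Ioi_mem_nhds h4] with x hx using hzr x hx
  · intro t ht
    rw [mem_Icc, not_and_or, not_le, not_le] at ht
    rcases ht with ht | ht
    · exact hzl t ht
    · exact hzr t ht

/-- All cutoffs are translates and rescalings of one fixed bump, so `D` depends on `n` alone; this
keeps the final constant uniform. -/
theorem exists_ball_cutoff (n : ℕ) : ∃ D : ℝ, 0 ≤ D ∧ ∀ (x₀ : Rn n) (ρ : ℝ), 0 < ρ →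
    ∃ ζ : Rn n → ℝ, ContDiff ℝ ∞ ζ ∧ tsupport ζ ⊆ Metric.closedBall x₀ (3 / 2 * ρ) ∧
      (∀ x ∈ Metric.ball x₀ ρ, ζ x = 1) ∧ (∀ x, 0 ≤ ζ x) ∧ (∀ x, ζ x ≤ 1) ∧
      ∀ x, ‖gradient ζ x‖ ≤ D / ρ := by
  let η : ContDiffBump (0 : Rn n) := ⟨1, 3 / 2, one_pos, by norm_num⟩
  have hη : ContDiff ℝ ∞ η := η.contDiff
  obtain ⟨D, hD⟩ := (hη.continuous_fderiv (by simp)).bounded_above_of_compact_support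
    (η.hasCompactSupport.fderiv ℝ)
  refine ⟨D, (norm_nonneg _).trans (hD 0), fun x₀ ρ hρ => ?_⟩
  have hnorm : ∀ x, ‖ρ⁻¹ • (x - x₀)‖ = ‖x - x₀‖ / ρ := fun x => by
    rw [norm_smul, norm_inv, Real.norm_of_nonneg hρ.le, div_eq_inv_mul]
  refine ⟨fun x => η (ρ⁻¹ • (x - x₀)), by fun_prop, ?_, ?_, fun x => η.nonneg, fun x => η.le_one, ?_⟩
  · refine closure_minimal ?_ Metric.isClosed_closedBall
    intro x hx
    have hx' : ρ⁻¹ • (x - x₀) ∈ Function.support η := hx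
    rw [η.support_eq, mem_ball_zero_iff, hnorm, div_lt_iff₀ hρ] at hx'
    rw [mem_closedBall_iff_norm]
    exact hx'.le
  · intro x hx
    refine η.one_of_mem_closedBall ?_
    rw [mem_closedBall_zero_iff, hnorm, div_le_iff₀ hρ, one_mul]
    exact (mem_ball_iff_norm.1 hx).le
  · intro x
    have h1 : HasFDerivAt (fun x : Rn n => ρ⁻¹ • (x - x₀)) (ρ⁻¹ • ContinuousLinearMap.id ℝ (Rn n)) x :=
      ((hasFDerivAt_id x).sub_const x₀).const_smul ρ⁻¹
    have h2 : HasFDerivAt η (fderiv ℝ η (ρ⁻¹ • (x - x₀))) (ρ⁻¹ • (x - x₀)) :=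
      (hη.differentiable (by simp)).differentiableAt.hasFDerivAt
    have h3 := (HasFDerivAt.comp x h2 h1).fderiv
    simp only [Function.comp_def] at h3
    rw [gradient, LinearIsometryEquiv.norm_map, h3, ContinuousLinearMap.comp_smul,
      ContinuousLinearMap.comp_id, norm_smul, norm_inv, Real.norm_of_nonneg hρ.le, inv_mul_eq_div]
    gcongr
    exact hD _

/-- Lebesgue differentiation of the averages over `(t, t + s)`. -/
theorem ae_le_of_forall_intervalIntegral_le {I : ℝ → ℝ} (hI : LocallyIntegrable I) {a b M : ℝ}
    (h : ∀ s t, a < s → s < t → t < b → ∫ τ in s..t, I τ ≤ (t - s) * M) :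
    ∀ᵐ t ∂(volume.restrict (Ioo a b)), I t ≤ M := by
  rw [ae_restrict_iff' measurableSet_Ioo]
  filter_upwards [_root_.LocallyIntegrable.ae_hasDerivAt_integral hI] with t ht htab
  have h1 := (ht t).tendsto_slope_zero_right
  refine le_of_tendsto h1 ?_
  have h2 : ∀ᶠ s : ℝ in 𝓝 0, t + s < b :=
    (continuous_const.add continuous_id).tendsto' 0 t (by simp) |>.eventually (gt_mem_nhds htab.2)
  filter_upwards [self_mem_nhdsWithin, mem_nhdsWithin_of_mem_nhds h2] with s hs hs'
  have hs0 : (0 : ℝ) < s := hs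
  have := h t (t + s) htab.1 (by linarith) hs'
  simp only [intervalIntegral.integral_same, sub_zero, smul_eq_mul]
  rw [inv_mul_le_iff₀ hs0]
  simpa using this

theorem ofReal_mul_integral_le {X : Type*} [MeasurableSpace X] {μ : Measure X} {K Q : Set X}
    (hKQ : K ⊆ Q) {g h : X → ℝ} {κ γ : ℝ} (hκ : 0 ≤ κ) (hκγ : κ ≤ γ)
    (hg : IntegrableOn g K μ) (hg0 : ∀ᵐ z ∂(μ.restrict K), 0 ≤ g z)
    (hgh : ∀ᵐ z ∂(μ.restrict K), g z ≤ h z) :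
    ENNReal.ofReal (κ * ∫ z in K, g z ∂μ) ≤ ENNReal.ofReal γ * ∫⁻ z in Q, ENNReal.ofReal (h z) ∂μ := by
  rw [ENNReal.ofReal_mul hκ, ofReal_integral_eq_lintegral_ofReal hg hg0]
  gcongr ?_ * ?_
  · exact ENNReal.ofReal_le_ofReal hκγ
  · refine (lintegral_mono_ae ?_).trans (lintegral_mono_set hKQ)
    filter_upwards [hgh] with z hz using ENNReal.ofReal_le_ofReal hz

theorem ae_ae_slice {n : ℕ} {P : Rn n × ℝ → Prop} (h : ∀ᵐ z, P z) : ∀ᵐ t, ∀ᵐ x, P (x, t) := by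
  have h1 : ∀ᵐ z ∂((volume : Measure ℝ).prod (volume : Measure (Rn n))), P z.swap :=
    (Measure.measurePreserving_swap (μ := (volume : Measure ℝ))
      (ν := (volume : Measure (Rn n)))).quasiMeasurePreserving.ae h
  exact Measure.ae_ae_of_ae_prod h1

/-! ### Estimates on cylinders -/

/-- Energy estimates on a compact cylinder, in terms of the gradient bound `D` of the spatial
cutoff function. -/
theorem PME.IsNonnegLocalWeakSolution.cylinder_bounds {n : ℕ} {E : Set (Rn n)}
    {T m ν L : ℝ} {A : Rn n × ℝ → ℝ → Rn n → Rn n} {f u : Rn n × ℝ → ℝ} {G : Rn n × ℝ → Rn n}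
    (hm : 0 < m) (hm1 : m < 1) (hν : 0 < ν) (hνL : ν ≤ L) (hA : StructureConditions E T ν L A)
    (hf : MemLpLoc f ⊤ (spaceTime E T))
    (hu : IsNonnegLocalWeakSolution E T m A f u G) {x₀ : Rn n} {t₀ s ρ : ℝ} (hs : 0 < s)
    (hρ : 0 < ρ)
    {K : Set (Rn n × ℝ)}
    (hKdef : K = Metric.closedBall x₀ (7 / 4 * ρ) ×ˢ Icc (t₀ - 3 * s) (t₀ + 3 * s))
    (hx₀ : Metric.closedBall x₀ (7 / 4 * ρ) ⊆ E)
    (ht₀ : Icc (t₀ - 3 * s) (t₀ + 3 * s) ⊆ Ioo 0 T) {c : ℝ} (hc : 0 ≤ c) {ζ : Rn n → ℝ} {D : ℝ}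
    (hζ : ContDiff ℝ ∞ ζ) (hζs : tsupport ζ ⊆ Metric.closedBall x₀ (3 / 2 * ρ))
    (hζb : ∀ x ∈ Metric.ball x₀ ρ, ζ x = 1) (hζ0 : ∀ x, 0 ≤ ζ x) (hζ1 : ∀ x, ζ x ≤ 1)
    (hD : ∀ x, ‖gradient ζ x‖ ≤ D / ρ) {M : ℝ}
    (hM : M = s⁻¹ * (∫ z in K, bregman m (u z) c)
      + (2 * L ^ 2 * D ^ 2 / ν + 1 / 2) / ρ ^ 2 * (∫ z in K, (u z ^ m - c ^ m) ^ 2)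
      + 1 / 2 * ∫ z in K, ρ ^ 2 * f z ^ 2) :
    (∀ᵐ t ∂(volume.restrict (Ioo (t₀ - s) (t₀ + s))), ∫⁻ x in Metric.ball x₀ ρ,
        ENNReal.ofReal (|u (x, t) ^ m - c ^ m| * |u (x, t) - c|)
      ≤ ENNReal.ofReal ((m + 1) / m * M)) ∧
    ∫⁻ z in Metric.ball x₀ ρ ×ˢ Ioo (t₀ - s) (t₀ + s), ENNReal.ofReal (‖G z‖ ^ 2)
      ≤ ENNReal.ofReal (2 / ν * M) := by
  have hK : IsCompact K := hKdef ▸ (isCompact_closedBall _ _).prod isCompact_Icc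
  have hKm := hK.measurableSet
  have hKE : K ⊆ spaceTime E T := hKdef ▸ prod_mono hx₀ ht₀
  have : IsFiniteMeasure ((volume : Measure (Rn n × ℝ)).restrict K) :=
    ⟨by simpa using hK.measure_lt_top⟩
  have huK : MemLp u (ENNReal.ofReal (m + 1)) (volume.restrict K) := hKdef ▸
    hu.continuous.memLp_prod (by simp [hm.le]) ENNReal.ofReal_ne_top
      (isCompact_closedBall _ _) hx₀ ht₀
  have hu0 : ∀ᵐ z ∂(volume.restrict K), 0 ≤ u z :=
    ae_mono (Measure.restrict_mono hKE le_rfl) hu.nonneg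
  have hFi : IntegrableOn (fun z => bregman m (u z) c) K := integrable_bregman hm huK hu0 c
  have hF0 : ∀ᵐ z ∂(volume.restrict K), 0 ≤ bregman m (u z) c := by
    filter_upwards [hu0] with z hz using bregman_nonneg hm hm1 hz hc
  have hGK := hu.sobolev.memLpLoc_grad _ hK hKE
  have hζc : HasCompactSupport ζ := HasCompactSupport.of_support_subset_isCompact
    (isCompact_closedBall x₀ (3 / 2 * ρ)) ((subset_tsupport ζ).trans hζs)
  have hζt : IsTestFunction E ζ := ⟨hζ, hζc, hζs.trans
    ((Metric.closedBall_subset_closedBall (by linarith)).trans hx₀)⟩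
  have hζsq : ∀ x, ζ x ^ 2 ≤ 1 := fun x => pow_le_one₀ (hζ0 x) (hζ1 x)
  have hmul : ∀ g : Rn n × ℝ → ℝ, Measurable g → (∀ z, 0 ≤ g z) → (∀ z, g z ≤ 1) →
      IntegrableOn (fun z => bregman m (u z) c * g z) K ∧
        0 ≤ ∫ z in K, bregman m (u z) c * g z ∧
        ∫ z in K, bregman m (u z) c * g z ≤ ∫ z in K, bregman m (u z) c := by
    intro g hg hg0 hg1
    have hi : IntegrableOn (fun z => bregman m (u z) c * g z) K :=
      hFi.mul_bdd (c := 1) hg.aestronglyMeasurable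
        (Eventually.of_forall fun z => by rw [Real.norm_of_nonneg (hg0 z)]; exact hg1 z)
    refine ⟨hi, integral_nonneg_of_ae ?_, integral_mono_ae hi hFi ?_⟩
    · filter_upwards [hF0] with z hz using mul_nonneg hz (hg0 z)
    · filter_upwards [hF0] with z hz using mul_le_of_le_one_right hz (hg1 z)
  set w : ℝ → ℝ → Rn n × ℝ → ℝ := fun a b z => ζ z.1 ^ 2 * (Ioo a b).indicator 1 z.2 with hw
  have hwm : ∀ a b, Measurable (w a b) := fun a b =>
    ((hζ.continuous.measurable.comp measurable_fst).pow_const 2).mul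
      ((measurable_one.indicator measurableSet_Ioo).comp measurable_snd)
  have hind : ∀ a b t, 0 ≤ (Ioo a b).indicator (1 : ℝ → ℝ) t ∧
      (Ioo a b).indicator (1 : ℝ → ℝ) t ≤ 1 := fun a b t =>
    ⟨indicator_nonneg (fun _ _ => zero_le_one) _, indicator_le_self' (by simp) t⟩
  have hw0 : ∀ a b z, 0 ≤ w a b z := fun a b z => mul_nonneg (sq_nonneg _) (hind a b z.2).1
  have hw1 : ∀ a b z, w a b z ≤ 1 := fun a b z =>
    mul_le_one₀ (hζsq _) (hind a b z.2).1 (hind a b z.2).2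
  -- The rising ramp is fixed on `(t₀ - 2s, t₀ - s)` and is paid for by the first term of `M`. The
  -- falling ramp `(b₀, b₁)` is free, and its contribution has the favourable sign.
  have henergy : ∀ b₀ b₁, t₀ - s ≤ b₀ → b₀ < b₁ → b₁ ≤ t₀ + 2 * s → ∃ χ : ℝ → ℝ,
      Continuous χ ∧ (∀ t, 0 ≤ χ t) ∧ (∀ t, χ t ≤ 1) ∧ (∀ t ∈ Icc (t₀ - s) b₀, χ t = 1) ∧
      ν / 2 * (∫ z in K, χ z.2 * ζ z.1 ^ 2 * ‖G z‖ ^ 2)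
        + (b₁ - b₀)⁻¹ * (∫ z in K, bregman m (u z) c * w b₀ b₁ z) ≤ M := by
    intro b₀ b₁ h0 h1 h2
    obtain ⟨χ, C, hχ, hχ', hχ0, hχ1, hχz, hχo⟩ :=
      exists_trapezoid (a₀ := t₀ - 2 * s) (by linarith) h0 h1
    refine ⟨χ, hχ.continuous, hχ0, hχ1, hχo, ?_⟩
    have hχs : tsupport χ ⊆ Icc (t₀ - 2 * s) (t₀ + 2 * s) := by
      refine closure_minimal (fun t ht => ?_) isClosed_Icc
      by_contra h
      exact ht (hχz t fun h' => h ⟨h'.1, h'.2.trans h2⟩)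
    have hχc : HasCompactSupport χ := HasCompactSupport.of_support_subset_isCompact
      (isCompact_Icc (a := t₀ - 2 * s) (b := t₀ + 2 * s)) ((subset_tsupport χ).trans hχs)
    -- The margins are `7/4 - 3/2 = 1/4` in units of `ρ` in space and `3s - 2s` in time.
    have hr : ∀ z ∈ tsupport ζ ×ˢ tsupport χ, ∀ y, ‖y‖ < min (ρ / 4) s → z + y ∈ K := by
      intro z hz y hy
      have hy1 := (norm_fst_le y).trans_lt hy
      have hy2 := (norm_snd_le y).trans_lt hy
      have hz1 := mem_closedBall_iff_norm.1 (hζs hz.1)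
      have hz2 := hχs hz.2
      rw [hKdef]
      refine ⟨?_, ?_⟩
      · rw [mem_closedBall_iff_norm, Prod.fst_add, add_sub_right_comm]
        refine (norm_add_le _ _).trans ?_
        linarith [min_le_left (ρ / 4) s]
      · have h3 := abs_lt.1 (hy2.trans_le (min_le_right (ρ / 4) s))
        exact ⟨by rw [Prod.snd_add]; linarith [hz2.1], by rw [Prod.snd_add]; linarith [hz2.2]⟩
    have hmain := hu.energy_le hm hm1 hν hνL hA hf hχ hχ' hχ0 hχ1 hχc
      (hχs.trans ((Icc_subset_Icc (by linarith) (by linarith)).trans ht₀)) hζt hζ0 hζ1 hD c hK hKE huK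
      (lt_min (by positivity) hs) hr hρ
    have hi1 := hmul _ (hwm (t₀ - 2 * s) (t₀ - s)) (hw0 _ _) (hw1 _ _)
    have hi2 := hmul _ (hwm b₀ b₁) (hw0 _ _) (hw1 _ _)
    have hsplit : ∫ z in K, bregman m (u z) c * (ζ z.1 ^ 2 *
        ((Ioo (t₀ - 2 * s) (t₀ - s)).indicator (fun _ => (t₀ - s - (t₀ - 2 * s))⁻¹) z.2
        - (Ioo b₀ b₁).indicator (fun _ => (b₁ - b₀)⁻¹) z.2))
        = s⁻¹ * (∫ z in K, bregman m (u z) c * w (t₀ - 2 * s) (t₀ - s) z)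
          - (b₁ - b₀)⁻¹ * (∫ z in K, bregman m (u z) c * w b₀ b₁ z) := by
      rw [← integral_const_mul, ← integral_const_mul,
        ← integral_sub (hi1.1.const_mul _) (hi2.1.const_mul _)]
      refine integral_congr_ae (Eventually.of_forall fun z => ?_)
      have hind' : ∀ a b k t, (Ioo a b).indicator (fun _ => k) t
          = k * (Ioo a b).indicator (1 : ℝ → ℝ) t := fun a b k t => by
        by_cases ht : t ∈ Ioo a b <;> simp [ht]
      simp only [hw, hind']
      rw [show t₀ - s - (t₀ - 2 * s) = s by ring]
      ring
    rw [hsplit] at hmain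
    have hM1 : s⁻¹ * (∫ z in K, bregman m (u z) c * w (t₀ - 2 * s) (t₀ - s) z)
        ≤ s⁻¹ * (∫ z in K, bregman m (u z) c) :=
      mul_le_mul_of_nonneg_left hi1.2.2 (by positivity)
    have hcoef : 2 * L ^ 2 * (D / ρ) ^ 2 / ν + 1 / (2 * ρ ^ 2)
        = (2 * L ^ 2 * D ^ 2 / ν + 1 / 2) / ρ ^ 2 := by field_simp
    rw [hcoef] at hmain
    rw [hM]
    linarith
  constructor
  · set Φ : Rn n × ℝ → ℝ := K.indicator (fun z => bregman m (u z) c * ζ z.1 ^ 2) with hΦ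
    have hΦi : Integrable Φ ((volume : Measure (Rn n)).prod (volume : Measure ℝ)) := by
      rw [← Measure.volume_eq_prod]
      exact (integrable_indicator_iff hKm).2 (hmul (fun z => ζ z.1 ^ 2)
        ((hζ.continuous.measurable.comp measurable_fst).pow_const 2)
        (fun z => sq_nonneg _) fun z => hζsq _).1
    have hIi : Integrable (fun t => ∫ x, Φ (x, t)) := hΦi.integral_prod_right
    have hle : ∀ᵐ t ∂(volume.restrict (Ioo (t₀ - s) (t₀ + s))), ∫ x, Φ (x, t) ≤ M := by
      -- Letting `χ` fall exactly on `(a, b)` and dropping the gradient term bounds the average of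
      -- the slice integrals over `(a, b)` by `M`.
      refine ae_le_of_forall_intervalIntegral_le hIi.locallyIntegrable fun a b ha hab hb => ?_
      obtain ⟨χ, -, hχ0, -, -, hχM⟩ := henergy a b ha.le hab (by linarith)
      have h1 : 0 ≤ ∫ z in K, χ z.2 * ζ z.1 ^ 2 * ‖G z‖ ^ 2 :=
        integral_nonneg fun z => mul_nonneg (mul_nonneg (hχ0 _) (sq_nonneg _)) (sq_nonneg _)
      have h2 : (b - a)⁻¹ * (∫ z in K, bregman m (u z) c * w a b z) ≤ M := by
        have := mul_nonneg (half_pos hν).le h1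
        linarith
      rw [inv_mul_le_iff₀ (sub_pos.2 hab)] at h2
      refine le_trans (le_of_eq ?_) h2
      rw [intervalIntegral.integral_of_le hab.le, integral_Ioc_eq_integral_Ioo,
        ← integral_indicator measurableSet_Ioo, ← integral_indicator hKm]
      have hΦw : Integrable (K.indicator fun z => bregman m (u z) c * w a b z)
          ((volume : Measure (Rn n)).prod (volume : Measure ℝ)) := by
        rw [← Measure.volume_eq_prod]
        exact (integrable_indicator_iff hKm).2 (hmul _ (hwm a b) (hw0 a b) (hw1 a b)).1
      rw [Measure.volume_eq_prod, integral_prod_symm _ hΦw]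
      refine integral_congr_ae (Eventually.of_forall fun t => ?_)
      by_cases ht : t ∈ Ioo a b
      · simp only [indicator_of_mem ht]
        refine integral_congr_ae (Eventually.of_forall fun x => ?_)
        by_cases hz : (x, t) ∈ K <;> simp [hΦ, hw, hz, ht]
      · simp only [indicator_of_notMem ht]
        rw [eq_comm]
        refine integral_eq_zero_of_ae (Eventually.of_forall fun x => ?_)
        by_cases hz : (x, t) ∈ K <;> simp [hw, hz, ht]
    have hu0' : ∀ᵐ z, z ∈ K → 0 ≤ u z := (ae_restrict_iff' hKm).1 hu0
    have hu0s : ∀ᵐ t, ∀ᵐ x, (x, t) ∈ K → 0 ≤ u (x, t) := ae_ae_slice hu0'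
    filter_upwards [hle, ae_restrict_of_ae hu0s, ae_restrict_of_ae hΦi.prod_left_ae,
      ae_restrict_mem measurableSet_Ioo] with t htM htu hti htI
    have hxK : ∀ x ∈ Metric.ball x₀ ρ, (x, t) ∈ K := fun x hx => by
      rw [hKdef]
      exact ⟨Metric.ball_subset_closedBall (Metric.ball_subset_ball (by linarith) hx),
        ⟨by linarith [htI.1], by linarith [htI.2]⟩⟩
    have hΦ0 : ∀ᵐ x, 0 ≤ (m + 1) / m * Φ (x, t) := by
      filter_upwards [htu] with x hx
      refine mul_nonneg (by positivity) ?_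
      by_cases hz : (x, t) ∈ K
      · rw [hΦ, indicator_of_mem hz]
        exact mul_nonneg (bregman_nonneg hm hm1 (hx hz) hc) (sq_nonneg _)
      · rw [hΦ, indicator_of_notMem hz]
    calc ∫⁻ x in Metric.ball x₀ ρ, ENNReal.ofReal (|u (x, t) ^ m - c ^ m| * |u (x, t) - c|)
        ≤ ∫⁻ x in Metric.ball x₀ ρ, ENNReal.ofReal ((m + 1) / m * Φ (x, t)) := by
          refine lintegral_mono_ae ?_
          filter_upwards [ae_restrict_of_ae htu, ae_restrict_mem Metric.isOpen_ball.measurableSet]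
            with x hx hxb
          refine ENNReal.ofReal_le_ofReal ?_
          have hz := hxK x hxb
          rw [hΦ, indicator_of_mem hz]
          simp only [hζb x hxb, one_pow, mul_one]
          rw [← abs_mul, abs_of_nonneg (rpow_sub_mul_sub_nonneg hm (hx hz) hc), div_mul_eq_mul_div,
            le_div_iff₀ hm, mul_comm]
          exact mul_le_bregman hm hm1 (hx hz) hc
      _ ≤ ∫⁻ x, ENNReal.ofReal ((m + 1) / m * Φ (x, t)) := setLIntegral_le_lintegral _ _
      _ = ENNReal.ofReal (∫ x, (m + 1) / m * Φ (x, t)) :=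
          (ofReal_integral_eq_lintegral_ofReal (hti.const_mul _) hΦ0).symm
      _ ≤ ENNReal.ofReal ((m + 1) / m * M) := by
          refine ENNReal.ofReal_le_ofReal ?_
          rw [integral_const_mul]
          exact mul_le_mul_of_nonneg_left htM (by positivity)
  -- For the gradient the fall starts only at `t₀ + s`, so `χ = 1` on the whole inner interval; the
  -- Bregman term is nonnegative and is dropped.
  · obtain ⟨χ, hχc, hχ0, hχ1, hχo, hχM⟩ := henergy (t₀ + s) (t₀ + 2 * s) (by linarith)
      (by linarith) le_rfl
    have h1 := mul_nonneg (inv_nonneg.2 (show 0 ≤ t₀ + 2 * s - (t₀ + s) by linarith))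
      (hmul _ (hwm (t₀ + s) (t₀ + 2 * s)) (hw0 _ _) (hw1 _ _)).2.1
    have h2 : ∫ z in K, χ z.2 * ζ z.1 ^ 2 * ‖G z‖ ^ 2 ≤ 2 / ν * M := by
      rw [div_mul_eq_mul_div, le_div_iff₀ hν]
      linarith
    have hcont : Continuous fun z : Rn n × ℝ => χ z.2 * ζ z.1 ^ 2 :=
      (hχc.comp continuous_snd).mul ((hζ.continuous.comp continuous_fst).pow 2)
    have hi3 : Integrable (fun z => χ z.2 * ζ z.1 ^ 2 * ‖G z‖ ^ 2) (volume.restrict K) := by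
      refine Integrable.bdd_mul (c := 1) hGK.norm.integrable_sq hcont.aestronglyMeasurable
        (Eventually.of_forall fun z => ?_)
      rw [Real.norm_of_nonneg (mul_nonneg (hχ0 _) (sq_nonneg _))]
      exact mul_le_one₀ (hχ1 _) (by positivity) (hζsq _)
    have hQK : Metric.ball x₀ ρ ×ˢ Ioo (t₀ - s) (t₀ + s) ⊆ K := by
      rw [hKdef]
      refine prod_mono ((Metric.ball_subset_ball (by linarith)).trans
        Metric.ball_subset_closedBall) ?_
      exact Ioo_subset_Icc_self.trans (Icc_subset_Icc (by linarith) (by linarith))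
    calc ∫⁻ z in Metric.ball x₀ ρ ×ˢ Ioo (t₀ - s) (t₀ + s), ENNReal.ofReal (‖G z‖ ^ 2)
        = ∫⁻ z in Metric.ball x₀ ρ ×ˢ Ioo (t₀ - s) (t₀ + s),
            ENNReal.ofReal (χ z.2 * ζ z.1 ^ 2 * ‖G z‖ ^ 2) := by
          refine setLIntegral_congr_fun (Metric.isOpen_ball.measurableSet.prod measurableSet_Ioo) ?_
          intro z hz
          simp only
          rw [hχo z.2 ⟨hz.2.1.le, hz.2.2.le⟩, hζb z.1 hz.1]
          simp
      _ ≤ ∫⁻ z in K, ENNReal.ofReal (χ z.2 * ζ z.1 ^ 2 * ‖G z‖ ^ 2) := lintegral_mono_set hQK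
      _ = ENNReal.ofReal (∫ z in K, χ z.2 * ζ z.1 ^ 2 * ‖G z‖ ^ 2) :=
          (ofReal_integral_eq_lintegral_ofReal hi3 (Eventually.of_forall fun z =>
            mul_nonneg (mul_nonneg (hχ0 _) (sq_nonneg _)) (sq_nonneg _))).symm
      _ ≤ ENNReal.ofReal (2 / ν * M) := ENNReal.ofReal_le_ofReal h2

/-! ### Conclusion -/

theorem lemma4p1 (n : ℕ) (hn : 2 ≤ n) (m ν L : ℝ)
    (hm : max ((n : ℝ) - 2) 0 / ((n : ℝ) + 2) < m) (hm1 : m < 1)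
    (hν : 0 < ν) (hνL : ν ≤ L) :
    ∃ γ : ℝ, 1 < γ ∧
      ∀ (E : Set (Rn n)) (T : ℝ) (A : Rn n × ℝ → ℝ → Rn n → Rn n)
        (f u : Rn n × ℝ → ℝ) (G : Rn n × ℝ → Rn n),
        IsOpen E → Bornology.IsBounded E → 0 < T →
        StructureConditions E T ν L A →
        MemLpLoc f ∞ (spaceTime E T) →
        IsNonnegLocalWeakSolution E T m A f u G →
        ∀ (z₀ : Rn n × ℝ) (θ ρ : ℝ), z₀ ∈ spaceTime E T → 0 < θ → 0 < ρ →
          parabolicCylinder z₀ (θ * (2 * ρ) ^ 2) (2 * ρ) ⊆ spaceTime E T →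
          ∀ c : ℝ, 0 ≤ c →
            (essSup (fun t => ∫⁻ x in Metric.ball z₀.1 ρ,
                  ENNReal.ofReal (|u (x, t) ^ m - c ^ m| ^ ((m + 1) / m)))
                (volume.restrict (timeInterval z₀.2 (θ * ρ ^ 2)))
              + essSup (fun t => ∫⁻ x in Metric.ball z₀.1 ρ,
                  ENNReal.ofReal (|u (x, t) ^ m - c ^ m| * |u (x, t) - c|))
                (volume.restrict (timeInterval z₀.2 (θ * ρ ^ 2)))
              + (∫⁻ z in parabolicCylinder z₀ (θ * ρ ^ 2) ρ, ENNReal.ofReal (‖G z‖ ^ 2))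
            ≤ ENNReal.ofReal (γ / (θ * ρ ^ 2)) *
                  (∫⁻ z in parabolicCylinder z₀ (θ * (2 * ρ) ^ 2) (2 * ρ),
                    ENNReal.ofReal (|u z ^ m - c ^ m| * |u z - c|))
              + ENNReal.ofReal (γ / ρ ^ 2) *
                  (∫⁻ z in parabolicCylinder z₀ (θ * (2 * ρ) ^ 2) (2 * ρ),
                    ENNReal.ofReal (|u z ^ m - c ^ m| ^ 2))
              + ENNReal.ofReal γ *
                  (∫⁻ z in parabolicCylinder z₀ (θ * (2 * ρ) ^ 2) (2 * ρ),
                    ENNReal.ofReal (ρ ^ 2 * |f z| ^ 2)))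
            ∧
            (essSup (fun t => ∫⁻ x in Metric.ball z₀.1 ρ,
                  ENNReal.ofReal (|u (x, t) ^ m - c ^ m| ^ ((m + 1) / m)))
                (volume.restrict (timeInterval z₀.2 (θ * ρ ^ 2)))
              + (∫⁻ z in parabolicCylinder z₀ (θ * ρ ^ 2) ρ, ENNReal.ofReal (‖G z‖ ^ 2))
            ≤ ENNReal.ofReal (γ / (θ * ρ ^ 2)) *
                  (∫⁻ z in parabolicCylinder z₀ (θ * (2 * ρ) ^ 2) (2 * ρ),
                    ENNReal.ofReal (|u z - c| ^ (m + 1)))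
              + ENNReal.ofReal (γ / ρ ^ 2) *
                  (∫⁻ z in parabolicCylinder z₀ (θ * (2 * ρ) ^ 2) (2 * ρ),
                    ENNReal.ofReal (|u z - c| ^ (2 * m)))
              + ENNReal.ofReal γ *
                  (∫⁻ z in parabolicCylinder z₀ (θ * (2 * ρ) ^ 2) (2 * ρ),
                    ENNReal.ofReal (ρ ^ 2 * |f z| ^ 2))) := by
  have hm0 : 0 < m := lt_of_le_of_lt (by positivity) hm
  obtain ⟨D, hD0, hcut⟩ := exists_ball_cutoff n
  -- Each of the two suprema costs `(m + 1)/m` and the gradient integral `2/ν`; the factor `1 + c₁`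
  -- in the final constant covers all three coefficients of `M`.
  set κ : ℝ := 2 * ((m + 1) / m) + 2 / ν with hκ
  set c₁ : ℝ := 2 * L ^ 2 * D ^ 2 / ν + 1 / 2 with hc₁
  have hquot : 1 < (m + 1) / m := by rw [lt_div_iff₀ hm0]; linarith
  have hν2 : 0 < 2 / ν := by positivity
  have hκ1 : 1 < κ := by rw [hκ]; linarith
  have hc₁0 : 0 < c₁ := by positivity
  refine ⟨κ * (1 + c₁), by nlinarith, ?_⟩
  intro E T A f u G hE _ hT hA hf hu z₀ θ ρ _ hθ hρ hQ c hc
  obtain ⟨ζ, hζ, hζs, hζb, hζ0, hζ1, hζD⟩ := hcut z₀.1 ρ hρ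
  set s : ℝ := θ * ρ ^ 2 with hs
  have hs0 : 0 < s := by positivity
  have hs4 : θ * (2 * ρ) ^ 2 = 4 * s := by rw [hs]; ring
  -- The outer open cylinder may touch the boundary of `E_T`, where `u` is not controlled. This
  -- compact cylinder lies between the inner and the outer one, so every Bochner integral over it is
  -- finite.
  set K : Set (Rn n × ℝ) :=
    Metric.closedBall z₀.1 (7 / 4 * ρ) ×ˢ Icc (z₀.2 - 3 * s) (z₀.2 + 3 * s) with hK
  have hB : Metric.closedBall z₀.1 (7 / 4 * ρ) ⊆ Metric.ball z₀.1 (2 * ρ) :=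
    Metric.closedBall_subset_ball (by linarith)
  have hJ : Icc (z₀.2 - 3 * s) (z₀.2 + 3 * s) ⊆ timeInterval z₀.2 (θ * (2 * ρ) ^ 2) := by
    rw [hs4]
    exact fun t ht => ⟨by linarith [ht.1], by linarith [ht.2]⟩
  have hKQ : K ⊆ parabolicCylinder z₀ (θ * (2 * ρ) ^ 2) (2 * ρ) := prod_mono hB hJ
  have hKE : K ⊆ spaceTime E T := hKQ.trans hQ
  have hx₀ : Metric.closedBall z₀.1 (7 / 4 * ρ) ⊆ E := fun x hx =>
    (hKE (show (x, z₀.2) ∈ K from ⟨hx, by linarith, by linarith⟩)).1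
  have ht₀ : Icc (z₀.2 - 3 * s) (z₀.2 + 3 * s) ⊆ Ioo 0 T := fun t ht =>
    (hKE (show (z₀.1, t) ∈ K from ⟨Metric.mem_closedBall_self (by positivity), ht⟩)).2
  have hKc : IsCompact K := (isCompact_closedBall _ _).prod isCompact_Icc
  have hKm := hKc.measurableSet
  have : IsFiniteMeasure ((volume : Measure (Rn n × ℝ)).restrict K) :=
    ⟨by simpa using hKc.measure_lt_top⟩
  have hu0 : ∀ᵐ z ∂(volume.restrict K), 0 ≤ u z :=
    ae_mono (Measure.restrict_mono hKE le_rfl) hu.nonneg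
  have huK : MemLp u (ENNReal.ofReal (m + 1)) (volume.restrict K) :=
    hu.continuous.memLp_prod (by simp [hm0.le]) ENNReal.ofReal_ne_top
      (isCompact_closedBall _ _) hx₀ ht₀
  have hFi : IntegrableOn (fun z => bregman m (u z) c) K := integrable_bregman hm0 huK hu0 c
  have hvi : IntegrableOn (fun z => (u z ^ m - c ^ m) ^ 2) K :=
    ((hu.sobolev.memLpLoc _ hKc hKE).sub (memLp_const (c ^ m))).integrable_sq
  have hfi : IntegrableOn (fun z => ρ ^ 2 * f z ^ 2) K :=
    (((hf _ hKc hKE).mono_exponent le_top : MemLp f 2 _).integrable_sq).const_mul _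
  obtain ⟨M, hM⟩ : ∃ M : ℝ, M = s⁻¹ * (∫ z in K, bregman m (u z) c)
      + c₁ / ρ ^ 2 * (∫ z in K, (u z ^ m - c ^ m) ^ 2)
      + 1 / 2 * ∫ z in K, ρ ^ 2 * f z ^ 2 := ⟨_, rfl⟩
  have hF0 : ∀ᵐ z ∂(volume.restrict K), 0 ≤ bregman m (u z) c := by
    filter_upwards [hu0] with z hz using bregman_nonneg hm0 hm1 hz hc
  have hM0 : 0 ≤ M := by
    have h1 : 0 ≤ ∫ z in K, bregman m (u z) c := integral_nonneg_of_ae hF0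
    have h2 : 0 ≤ ∫ z in K, (u z ^ m - c ^ m) ^ 2 := integral_nonneg fun z => sq_nonneg _
    have h3 : 0 ≤ ∫ z in K, ρ ^ 2 * f z ^ 2 := integral_nonneg fun z => by positivity
    rw [hM]
    positivity
  obtain ⟨hsup, hgrad⟩ := hu.cylinder_bounds hm0 hm1 hν hνL hA hf hs0 hρ hK hx₀ ht₀ hc hζ hζs hζb
    hζ0 hζ1 hζD hM
  -- Arbitrary majorants `g`, `h` let both estimates share one argument: the first takes the
  -- quantities themselves, the second the powers of `|u - c|` that dominate them.
  have hbound : ∀ g h : Rn n × ℝ → ℝ,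
      (∀ᵐ z ∂(volume.restrict K), |u z ^ m - c ^ m| * |u z - c| ≤ g z) →
      (∀ᵐ z ∂(volume.restrict K), |u z ^ m - c ^ m| ^ 2 ≤ h z) →
      ENNReal.ofReal (κ * M) ≤
        ENNReal.ofReal (κ * (1 + c₁) / s) *
            (∫⁻ z in parabolicCylinder z₀ (θ * (2 * ρ) ^ 2) (2 * ρ), ENNReal.ofReal (g z))
          + ENNReal.ofReal (κ * (1 + c₁) / ρ ^ 2) *
            (∫⁻ z in parabolicCylinder z₀ (θ * (2 * ρ) ^ 2) (2 * ρ), ENNReal.ofReal (h z))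
          + ENNReal.ofReal (κ * (1 + c₁)) *
            (∫⁻ z in parabolicCylinder z₀ (θ * (2 * ρ) ^ 2) (2 * ρ),
              ENNReal.ofReal (ρ ^ 2 * |f z| ^ 2)) := by
    intro g h hg hh
    have hexp : κ * M = κ / s * (∫ z in K, bregman m (u z) c)
        + κ * c₁ / ρ ^ 2 * (∫ z in K, (u z ^ m - c ^ m) ^ 2)
        + κ / 2 * ∫ z in K, ρ ^ 2 * f z ^ 2 := by rw [hM]; ring
    rw [hexp]
    refine (ENNReal.ofReal_add_le.trans (add_le_add_left ENNReal.ofReal_add_le _)).trans ?_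
    refine add_le_add (add_le_add ?_ ?_) ?_
    · refine ofReal_mul_integral_le hKQ (by positivity) ?_ hFi hF0 ?_
      · gcongr; nlinarith
      · filter_upwards [hu0, hg] with z hz hgz
        refine (bregman_le hm0 hm1 hz hc).trans ((le_abs_self _).trans ?_)
        rwa [abs_mul]
    · refine ofReal_mul_integral_le hKQ (by positivity) ?_ hvi
        (Eventually.of_forall fun z => sq_nonneg _) ?_
      · gcongr; linarith
      · filter_upwards [hh] with z hz
        rwa [sq_abs] at hz
    · refine ofReal_mul_integral_le hKQ (by positivity) (by nlinarith) hfi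
        (Eventually.of_forall fun z => by positivity) (Eventually.of_forall fun z => ?_)
      rw [sq_abs]
  have hsup' : essSup (fun t => ∫⁻ x in Metric.ball z₀.1 ρ,
      ENNReal.ofReal (|u (x, t) ^ m - c ^ m| * |u (x, t) - c|))
      (volume.restrict (timeInterval z₀.2 s)) ≤ ENNReal.ofReal ((m + 1) / m * M) :=
    essSup_le_of_ae_le _ hsup
  have hpow : essSup (fun t => ∫⁻ x in Metric.ball z₀.1 ρ,
      ENNReal.ofReal (|u (x, t) ^ m - c ^ m| ^ ((m + 1) / m)))
      (volume.restrict (timeInterval z₀.2 s)) ≤ ENNReal.ofReal ((m + 1) / m * M) := by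
    refine essSup_le_of_ae_le _ ?_
    filter_upwards [hsup, ae_restrict_of_ae (ae_ae_slice ((ae_restrict_iff' hKm).1 hu0)),
      ae_restrict_mem measurableSet_Ioo] with t ht htu htI
    refine le_trans (lintegral_mono_ae ?_) ht
    filter_upwards [ae_restrict_of_ae htu, ae_restrict_mem Metric.isOpen_ball.measurableSet]
      with x hx hxb
    refine ENNReal.ofReal_le_ofReal (abs_rpow_sub_rpow_rpow_le hm0 hm1 (hx ?_) hc)
    exact ⟨Metric.ball_subset_closedBall (Metric.ball_subset_ball (by linarith) hxb),
      by linarith [htI.1], by linarith [htI.2]⟩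
  have hsum : ENNReal.ofReal ((m + 1) / m * M) + ENNReal.ofReal ((m + 1) / m * M)
      + ENNReal.ofReal (2 / ν * M) = ENNReal.ofReal (κ * M) := by
    rw [← ENNReal.ofReal_add (by positivity) (by positivity),
      ← ENNReal.ofReal_add (by positivity) (by positivity), hκ]
    congr 1
    ring
  constructor
  · refine le_trans ?_ (hbound _ _ (Eventually.of_forall fun z => le_rfl)
      (Eventually.of_forall fun z => le_rfl))
    rw [← hsum]
    exact add_le_add (add_le_add hpow hsup') hgrad
  · refine le_trans ?_ (hbound _ _
      (hu0.mono fun z hz => abs_mul_abs_le_rpow hm0 hm1 hz hc)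
      (hu0.mono fun z hz => abs_sq_le_rpow hm0 hm1 hz hc))
    rw [← hsum]
    exact add_le_add (hpow.trans le_self_add) hgrad
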